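/- **Categories with a natural cone.** Let $\mathbf C$ be a category with a natural cone. That is, $\mathbf C$ is equipped with a class of morphisms called cofibrations, a functor $C:\mathbf C\to\mathbf C$ and natural transformations $\kappa:1\to C$, $\rho:CC\to C$ such that: 1. $\rho\,\kappa_C=\rho\,C\kappa=1_C$ and $\rho\,\rho_C=\rho\,C\rho$; 2. for a cofibration $i:B\to A$ and a morphism $f:B\to X$ the pushout $P\{i,f\}$ exists, the induced morphism $X\to P\{i,f\}$ is a cofibration, and $C$ carries this pushout square to a pushout square; 3. all $1_X$ and all $\kappa_X:X\to CX$ are cofibrations, composites of cofibrations are cofibrations, and for every cofibration $i$ the morphism $Ci$ has a retraction; 4. for every cofibration $i:B\to A$, with $\Sigma^i=P\{\kappa_B,i\}$, the morphism $i_1=\{Ci,\kappa_A\}:\Sigma^i\to CA$ is a cofibration. Here the conditions hold for every pushout square of the kind named. Put $i_0=i$ and $i_n=(i_{n-1})_1$. **Homotopy groups.** Let $i:B\to CA$ be a cofibration. * For $f_0,f_1:CA\to X$, a homotopy $F:f_0\simeq f_1$ rel. $i$ is a morphism $F:C^2A\to X$ with $F\,i_1=\{f_0\,\rho\,(Ci),f_1\}$.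 This is an equivalence relation on the morphisms $CA\to X$ with prescribed restriction along $i$. * $H_i(f_0,f_1)$ is the set of homotopies from $f_0$ to $f_1$ rel. $i$, modulo homotopy rel. $i_1$. * Let $\mu:C^2A\to C\,P\{i,i\}$ be an extension along $i_1$ of the morphism $\kappa\circ\bigl(\rho(Ci)\cup 1\bigr):\Sigma^i\to P\{i,i\}\to C\,P\{i,i\}$, and identify $C\,P\{i,i\}=P\{Ci,Ci\}$. For homotopies $F:f_0\simeq f_1$ and $G:f_1\simeq f_2$ rel. $i$ put $\overline F=\{F,f_0\rho\}\mu$ and $F*G=\{\overline F,G\}\mu$. * For $h:CA\to X$ the set $\pi_1^i(X,h)=H_i(h,h)$ is a group under $[F][G]=[F*G]$, with unit $[h\rho]$. For $n\ge 1$ put $\pi_n^i(X,h)=\pi_1^{i_{n-1}}(X,h\rho^{n-1})$. For a cofibration $i:B\to A$ and $h:CA\to X$ put $\pi_{n+1}^i(X,h)=\pi_n^{i_1}(X,h)$ for $n\ge1$. **Pairs.** A pair $(X,Y)$ is a cofibration $f:Y\to X$. A morphism from $(X,Y)$ to a pair $(X',Y')$ given by $f':Y'\to X'$ is a pair $(g,k)$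 of morphisms $g:X\to X'$, $k:Y\to Y'$ with $gf=f'k$. A morphism $(u,v):(X,Y)\to(X',Y')$ is a cofibration if $v$ and $\{f',u\}:P\{v,f\}\to X'$ are cofibrations. With the cone $C(X,Y)=(CX,CY)$, $\kappa=(\kappa,\kappa)$, $\rho=(\rho,\rho)$, pairs again form a category with a natural cone. For a cofibration $i:B\to A$, a pair $(X,Y)$ given by $f:Y\to X$, a morphism $h:CA\to Y$ and $n\ge1$, define $$\pi_{n+2}^i((X,Y),h)=\pi_{n+1}^{(Ci,i)}\bigl((X,Y),(fh\rho,h)\bigr),\qquad (Ci,i):(CB,B)\to(CA,A).$$ **Maps.** Let $n\ge1$. * $f_*:\pi_{n+1}^i(Y,h)\to\pi_{n+1}^i(X,fh)$ is $[F]\mapsto[fF]$. * $\theta_n:\pi_{n+2}^i(X,fh)\to\pi_{n+1}^{(i_1,1)}\bigl((X,Y),(fh\rho,h)\bigr)$ is the isomorphism $[F]\mapsto[(F,h\rho^n)]$, where $(i_1,1):(\Sigma^i,A)\to(CA,A)$ and $(\Sigma^i,A)$ is the pair given by the induced morphism $A\to\Sigma^i$. * $(1,1)^*:\pi_{n+1}^{(i_1,1)}\bigl((X,Y),(fh\rho,h)\bigr)\to\pi_{n+1}^{(Ci,i)}\bigl((X,Y),(fh\rho,h)\bigr)$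 is the homomorphism induced by the commutative square $(1,1)(Ci,i)=(i_1,1)(\bar\imath,i)$, with $\bar\imath:CB\to\Sigma^i$ the induced morphism. It is induced by composition with $C^{n+1}(1,1)$. * $j_n=(1,1)^*\theta_n:\pi_{n+2}^i(X,fh)\to\pi_{n+2}^i((X,Y),h)$. * $\delta_n:\pi_{n+2}^i((X,Y),h)\to\pi_{n+1}^i(Y,h)$ is $[(F,G)]\mapsto[G]$. **Theorem.** Let $\mathbf C$ be a category with a natural cone, $i:B\to A$ and $f:Y\to X$ cofibrations, and $h:CA\to Y$ a morphism. Then the sequence of groups and homomorphisms $$\cdots\to\pi_3^i(Y,h)\xrightarrow{f_*}\pi_3^i(X,fh)\xrightarrow{j_1}\pi_3^i((X,Y),h)\xrightarrow{\delta_1}\pi_2^i(Y,h)\xrightarrow{f_*}\pi_2^i(X,fh)$$ is exact. That is, for every $n\ge 1$, $$\operatorname{im}\bigl(f_*:\pi_{n+2}^i(Y,h)\to\pi_{n+2}^i(X,fh)\bigr)=\ker j_n,\qquad \operatorname{im} j_n=\ker\delta_n,$$ $$\operatorname{im}\delta_n=\ker\bigl(f_*:\pi_{n+1}^i(Y,h)\to\pi_{n+1}^i(X,fh)\bigr).$$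 -/

import Mathlib

open CategoryTheory CategoryTheory.Limits

universe v v' u w

namespace GenHtpy

/-- A pushout square of `i : B ⟶ A` and `f : B ⟶ X`, with its universal property as data. -/
structure PushoutSquare {C : Type u} [Category.{v} C] {A B X : C} (i : B ⟶ A) (f : B ⟶ X) where
  pt : C
  inl : A ⟶ pt
  inr : X ⟶ pt
  w : i ≫ inl = f ≫ inr
  desc : ∀ {Z : C} (a : A ⟶ Z) (b : X ⟶ Z), i ≫ a = f ≫ b → (pt ⟶ Z)
  inl_desc : ∀ {Z : C} (a : A ⟶ Z) (b : X ⟶ Z) (h : i ≫ a = f ≫ b), inl ≫ desc a b h = a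
  inr_desc : ∀ {Z : C} (a : A ⟶ Z) (b : X ⟶ Z) (h : i ≫ a = f ≫ b), inr ≫ desc a b h = b
  hom_ext : ∀ {Z : C} (s t : pt ⟶ Z), inl ≫ s = inl ≫ t → inr ≫ s = inr ≫ t → s = t

theorem PushoutSquare.inl_desc_assoc {C : Type u} [Category.{v} C] {A B X : C} {i : B ⟶ A}
    {f : B ⟶ X} (S : PushoutSquare i f) {Z Z' : C} (a : A ⟶ Z) (b : X ⟶ Z) (h : i ≫ a = f ≫ b)
    (k : Z ⟶ Z') : S.inl ≫ S.desc a b h ≫ k = a ≫ k := by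
  rw [← Category.assoc, S.inl_desc]

theorem PushoutSquare.inr_desc_assoc {C : Type u} [Category.{v} C] {A B X : C} {i : B ⟶ A}
    {f : B ⟶ X} (S : PushoutSquare i f) {Z Z' : C} (a : A ⟶ Z) (b : X ⟶ Z) (h : i ≫ a = f ≫ b)
    (k : Z ⟶ Z') : S.inr ≫ S.desc a b h ≫ k = b ≫ k := by
  rw [← Category.assoc, S.inr_desc]

theorem PushoutSquare.isPushout {C : Type u} [Category.{v} C] {A B X : C} {i : B ⟶ A} {f : B ⟶ X}
    (S : PushoutSquare i f) : IsPushout i f S.inl S.inr :=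
  ⟨⟨S.w⟩, ⟨PushoutCocone.IsColimit.mk S.w (fun s => S.desc s.inl s.inr s.condition)
    (fun _ => S.inl_desc _ _ _) (fun _ => S.inr_desc _ _ _)
    (fun s _ h₁ h₂ => S.hom_ext _ _ (h₁.trans (S.inl_desc _ _ s.condition).symm)
      (h₂.trans (S.inr_desc _ _ s.condition).symm))⟩⟩

/-- A category with a natural cone (a `C`-category): a cone functor `C` with an inclusion `κ : 1 ⟶ C`
and a projection `ρ : C C ⟶ C` satisfying the cone axiom (that is, a monad `(C, κ, ρ)`), together
with a class `cof` of cofibrations satisfying the pushout axiom, the cofibration axiom and the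
relative cone axiom. `po` is a choice of the pushout `P{i, f}` of a cofibration `i : B ⟶ A` and a
morphism `f : B ⟶ X`; the axioms are about every pushout square. -/
class NaturalCone (C : Type u) [Category.{v} C] where
  /-- the cone functor, with `η = κ` and `μ = ρ` -/
  monad : Monad C
  /-- the cofibrations -/
  cof : MorphismProperty C
  /-- pushout axiom: the pushout `P{i, f}` of a cofibration `i` exists -/
  po : ∀ {A B X : C} (i : B ⟶ A) (f : B ⟶ X), cof i → PushoutSquare i f
  /-- pushout axiom: the morphism induced by a cofibration is a cofibration -/
  cof_of_isPushout : ∀ {A B X P : C} {i : B ⟶ A} {f : B ⟶ X} {f' : A ⟶ P} {i' : X ⟶ P},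
    cof i → IsPushout i f f' i' → cof i'
  /-- pushout axiom: the cone functor preserves pushouts of cofibrations -/
  cone_isPushout : ∀ {A B X P : C} {i : B ⟶ A} {f : B ⟶ X} {f' : A ⟶ P} {i' : X ⟶ P},
    cof i → IsPushout i f f' i' →
      IsPushout (monad.map i) (monad.map f) (monad.map f') (monad.map i')
  /-- cofibration axiom -/
  cof_id : ∀ X : C, cof (𝟙 X)
  /-- cofibration axiom -/
  cof_unit : ∀ X : C, cof (monad.η.app X)
  /-- cofibration axiom -/
  cof_comp : ∀ {X Y Z : C} (f : X ⟶ Y) (g : Y ⟶ Z), cof f → cof g → cof (f ≫ g)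
  /-- cofibration axiom, the nullhomotopy extension property -/
  nep : ∀ {A B : C} (i : B ⟶ A), cof i → ∃ r : monad.obj A ⟶ monad.obj B, monad.map i ≫ r = 𝟙 _
  /-- relative cone axiom: `{C i, κ} : P{κ, i} ⟶ C A` is a cofibration -/
  cof_relCone : ∀ {A B S : C} {i : B ⟶ A} {l : monad.obj B ⟶ S} {r : A ⟶ S}
    (s : S ⟶ monad.obj A), cof i → IsPushout (monad.η.app B) i l r →
      l ≫ s = monad.map i → r ≫ s = monad.η.app A → cof s

section Basic

variable {C : Type u} [Category.{v} C] [NaturalCone C]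

/-- The cone `C X`. -/
abbrev cone (X : C) : C := (NaturalCone.monad (C := C)).obj X

/-- The cone `C f` of a morphism. -/
abbrev coneMap {X Y : C} (f : X ⟶ Y) : cone X ⟶ cone Y := (NaturalCone.monad (C := C)).map f

/-- The inclusion into the cone. -/
abbrev κ (X : C) : X ⟶ cone X := (NaturalCone.monad (C := C)).η.app X

/-- The projection from the double cone. -/
abbrev ρ (X : C) : cone (cone X) ⟶ cone X := (NaturalCone.monad (C := C)).μ.app X

/-- Being a cofibration. -/
abbrev IsCof {X Y : C} (f : X ⟶ Y) : Prop := NaturalCone.cof f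

theorem κ_nat {X Y : C} (f : X ⟶ Y) : κ X ≫ coneMap f = f ≫ κ Y :=
  ((NaturalCone.monad (C := C)).η.naturality f).symm

theorem κ_nat_assoc {X Y Z : C} (f : X ⟶ Y) (k : cone Y ⟶ Z) :
    κ X ≫ coneMap f ≫ k = f ≫ κ Y ≫ k := by
  simpa only [Category.assoc] using congrArg (· ≫ k) (κ_nat f)

theorem ρ_nat {X Y : C} (f : X ⟶ Y) : ρ X ≫ coneMap f = coneMap (coneMap f) ≫ ρ Y :=
  ((NaturalCone.monad (C := C)).μ.naturality f).symm

theorem ρ_nat_assoc {X Y Z : C} (f : X ⟶ Y) (k : cone Y ⟶ Z) :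
    ρ X ≫ coneMap f ≫ k = coneMap (coneMap f) ≫ ρ Y ≫ k := by
  simpa only [Category.assoc] using congrArg (· ≫ k) (ρ_nat f)

theorem κ_ρ (X : C) : κ (cone X) ≫ ρ X = 𝟙 _ := (NaturalCone.monad (C := C)).left_unit X

theorem κ_ρ_assoc (X : C) {Z : C} (k : cone X ⟶ Z) :
    κ (cone X) ≫ ρ X ≫ k = k := by
  rw [← Category.assoc, κ_ρ, Category.id_comp]

theorem coneκ_ρ (X : C) : coneMap (κ X) ≫ ρ X = 𝟙 _ := (NaturalCone.monad (C := C)).right_unit X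

theorem coneκ_ρ_assoc (X : C) {Z : C} (k : cone X ⟶ Z) :
    coneMap (κ X) ≫ ρ X ≫ k = k := by
  rw [← Category.assoc, coneκ_ρ, Category.id_comp]

theorem ρ_ρ (X : C) : ρ (cone X) ≫ ρ X = coneMap (ρ X) ≫ ρ X :=
  ((NaturalCone.monad (C := C)).assoc X).symm

theorem ρ_ρ_assoc (X : C) {Z : C} (k : cone X ⟶ Z) :
    ρ (cone X) ≫ ρ X ≫ k = coneMap (ρ X) ≫ ρ X ≫ k := by
  simpa only [Category.assoc] using congrArg (· ≫ k) (ρ_ρ X)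

theorem coneMap_comp {X Y Z : C} (f : X ⟶ Y) (g : Y ⟶ Z) :
    coneMap (f ≫ g) = coneMap f ≫ coneMap g := (NaturalCone.monad (C := C)).map_comp f g

theorem coneMap_id (X : C) : coneMap (𝟙 X) = 𝟙 _ := (NaturalCone.monad (C := C)).map_id X

theorem coneMap_sq {X Y Y' Z : C} {f : X ⟶ Y} {g : Y ⟶ Z} {f' : X ⟶ Y'} {g' : Y' ⟶ Z}
    (h : f ≫ g = f' ≫ g') : coneMap f ≫ coneMap g = coneMap f' ≫ coneMap g' := by
  rw [← coneMap_comp, h, coneMap_comp]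

theorem coneMap_sq_assoc {X Y Y' Z W : C} {f : X ⟶ Y} {g : Y ⟶ Z} {f' : X ⟶ Y'} {g' : Y' ⟶ Z}
    (h : f ≫ g = f' ≫ g') (k : cone Z ⟶ W) :
    coneMap f ≫ coneMap g ≫ k = coneMap f' ≫ coneMap g' ≫ k := by
  simpa only [Category.assoc] using congrArg (· ≫ k) (coneMap_sq h)

/-- A cofibration with target `A`. -/
structure Cofib (A : C) where
  src : C
  hom : src ⟶ A
  isCof : IsCof hom

namespace Cofib

variable {A : C} (i : Cofib A)

/-- The chosen pushout of `κ : B ⟶ C B` and `i : B ⟶ A`; its object is the relative cone `Σ^i`. -/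
abbrev relCone : PushoutSquare (κ i.src) i.hom :=
  NaturalCone.po (κ i.src) i.hom (NaturalCone.cof_unit i.src)

/-- The cofibration `i₁ = {C i, κ} : Σ^i ⟶ C A`. -/
def next : Cofib (cone A) where
  src := i.relCone.pt
  hom := i.relCone.desc (coneMap i.hom) (κ A) (κ_nat i.hom)
  isCof := NaturalCone.cof_relCone _ i.isCof i.relCone.isPushout
    (i.relCone.inl_desc _ _ _) (i.relCone.inr_desc _ _ _)

/-- The induced morphism `C B ⟶ Σ^i`. -/
def nextInl : cone i.src ⟶ i.next.src := i.relCone.inl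

/-- The induced morphism `A ⟶ Σ^i`. -/
def nextInr : A ⟶ i.next.src := i.relCone.inr

theorem next_isPushout : IsPushout (κ i.src) i.hom i.nextInl i.nextInr := i.relCone.isPushout

theorem inl_next : i.nextInl ≫ i.next.hom = coneMap i.hom := i.relCone.inl_desc _ _ _

theorem inl_next_assoc {Z : C} (k : cone A ⟶ Z) :
    i.nextInl ≫ i.next.hom ≫ k = coneMap i.hom ≫ k := by
  simpa only [Category.assoc] using congrArg (· ≫ k) (inl_next i)

theorem inr_next : i.nextInr ≫ i.next.hom = κ A := i.relCone.inr_desc _ _ _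

theorem inr_next_assoc {Z : C} (k : cone A ⟶ Z) :
    i.nextInr ≫ i.next.hom ≫ k = κ A ≫ k := by
  simpa only [Category.assoc] using congrArg (· ≫ k) (inr_next i)

theorem next_ext {X : C} {F G : cone A ⟶ X} (h₁ : coneMap i.hom ≫ F = coneMap i.hom ≫ G)
    (h₂ : κ A ≫ F = κ A ≫ G) : i.next.hom ≫ F = i.next.hom ≫ G :=
  i.next_isPushout.hom_ext (by simpa only [inl_next_assoc] using h₁)
    (by simpa only [inr_next_assoc] using h₂)

theorem cone_next_isPushout : IsPushout (coneMap (κ i.src)) (coneMap i.hom)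
    (coneMap i.nextInl) (coneMap i.nextInr) :=
  NaturalCone.cone_isPushout (NaturalCone.cof_unit _) i.next_isPushout

theorem cone_inl_next : coneMap i.nextInl ≫ coneMap i.next.hom = coneMap (coneMap i.hom) := by
  rw [← coneMap_comp, inl_next]

theorem cone_inl_next_assoc {Z : C} (k : cone (cone A) ⟶ Z) :
    coneMap i.nextInl ≫ coneMap i.next.hom ≫ k = coneMap (coneMap i.hom) ≫ k := by
  simpa only [Category.assoc] using congrArg (· ≫ k) (cone_inl_next i)

theorem cone_inr_next : coneMap i.nextInr ≫ coneMap i.next.hom = coneMap (κ A) := by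
  rw [← coneMap_comp, inr_next]

theorem cone_inr_next_assoc {Z : C} (k : cone (cone A) ⟶ Z) :
    coneMap i.nextInr ≫ coneMap i.next.hom ≫ k = coneMap (κ A) ≫ k := by
  simpa only [Category.assoc] using congrArg (· ≫ k) (cone_inr_next i)

theorem cone_next_ext {X : C} {F G : cone (cone A) ⟶ X}
    (h₁ : coneMap (coneMap i.hom) ≫ F = coneMap (coneMap i.hom) ≫ G)
    (h₂ : coneMap (κ A) ≫ F = coneMap (κ A) ≫ G) :
    coneMap i.next.hom ≫ F = coneMap i.next.hom ≫ G :=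
  i.cone_next_isPushout.hom_ext (by simpa only [cone_inl_next_assoc] using h₁)
    (by simpa only [cone_inr_next_assoc] using h₂)

/-- The cofibration `C i : C B ⟶ C A`. -/
def coneCofib : Cofib (cone A) where
  src := cone i.src
  hom := coneMap i.hom
  isCof := by
    rw [← i.inl_next]
    exact NaturalCone.cof_comp _ _ (NaturalCone.cof_of_isPushout i.isCof i.next_isPushout.flip)
      i.next.isCof

/-- A morphism into a cone extends along every cofibration. -/
theorem exists_extension {Z : C} (g : i.src ⟶ cone Z) : ∃ G : A ⟶ cone Z, i.hom ≫ G = g := by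
  obtain ⟨r, hr⟩ := NaturalCone.nep i.hom i.isCof
  refine ⟨κ A ≫ r ≫ coneMap g ≫ ρ Z, ?_⟩
  have h1 : i.hom ≫ κ A = κ i.src ≫ coneMap i.hom := (κ_nat _).symm
  rw [reassoc_of% h1]
  have h2 : coneMap i.hom ≫ r = 𝟙 _ := hr
  rw [reassoc_of% h2, κ_nat_assoc, κ_ρ, Category.comp_id]

theorem exists_next_extension {Z : C} (g : cone i.src ⟶ cone Z) (g' : A ⟶ cone Z)
    (h : κ i.src ≫ g = i.hom ≫ g') :
    ∃ G : cone A ⟶ cone Z, coneMap i.hom ≫ G = g ∧ κ A ≫ G = g' := by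
  obtain ⟨G, hG⟩ := i.next.exists_extension (i.next_isPushout.desc g g' h)
  refine ⟨G, ?_, ?_⟩
  · rw [← i.inl_next, Category.assoc, hG, IsPushout.inl_desc]
  · rw [← i.inr_next, Category.assoc, hG, IsPushout.inr_desc]

end Cofib

/-- `Hom(C²A, X)^{{f₀ ρ (C i), f₁}(i₁)}`: the homotopies from `f₀` to `f₁` relative to a cofibration
`i : B ⟶ C A`, that is, the morphisms `F : C²A ⟶ X` with `F i₁ = {f₀ ρ (C i), f₁}`, where
`i₁ = {C i, κ}`. -/
structure Htpy {A X : C} (i : Cofib (cone A)) (f₀ f₁ : cone A ⟶ X) where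
  hom : cone (cone A) ⟶ X
  left : coneMap i.hom ≫ hom = coneMap i.hom ≫ ρ A ≫ f₀
  right : κ (cone A) ≫ hom = f₁

namespace Htpy

variable {A X : C} {i : Cofib (cone A)}

@[ext]
theorem ext {f₀ f₁ : cone A ⟶ X} {F G : Htpy i f₀ f₁} (h : F.hom = G.hom) : F = G := by
  cases F; cases G; cases h; rfl

theorem boundary {f₀ f₁ : cone A ⟶ X} (F : Htpy i f₀ f₁) : i.hom ≫ f₀ = i.hom ≫ f₁ := by
  have h := congrArg (κ i.src ≫ ·) F.left
  simp only [κ_nat_assoc, κ_ρ_assoc, F.right] at h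
  exact h.symm

/-- The chosen pushout `P{i, i}`. -/
abbrev dbl (i : Cofib (cone A)) : PushoutSquare i.hom i.hom := NaturalCone.po i.hom i.hom i.isCof

theorem cone_dbl (i : Cofib (cone A)) :
    IsPushout (coneMap i.hom) (coneMap i.hom) (coneMap (dbl i).inl) (coneMap (dbl i).inr) :=
  NaturalCone.cone_isPushout i.isCof (dbl i).isPushout

/-- The morphism `{F, G} : C P{i, i} = P{C i, C i} ⟶ X`. -/
noncomputable def pair (i : Cofib (cone A)) (F G : cone (cone A) ⟶ X)
    (h : coneMap i.hom ≫ F = coneMap i.hom ≫ G) : cone (dbl i).pt ⟶ X := (cone_dbl i).desc F G h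

theorem inl_pair (F G : cone (cone A) ⟶ X) (h : coneMap i.hom ≫ F = coneMap i.hom ≫ G) :
    coneMap (dbl i).inl ≫ pair i F G h = F := (cone_dbl i).inl_desc _ _ _

theorem inl_pair_assoc (F G : cone (cone A) ⟶ X) (h : coneMap i.hom ≫ F = coneMap i.hom ≫ G) {Z : C}
    (k : X ⟶ Z) :
    coneMap (dbl i).inl ≫ pair i F G h ≫ k = F ≫ k := by
  simpa only [Category.assoc] using congrArg (· ≫ k) (inl_pair F G h)

theorem inr_pair (F G : cone (cone A) ⟶ X) (h : coneMap i.hom ≫ F = coneMap i.hom ≫ G) :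
    coneMap (dbl i).inr ≫ pair i F G h = G := (cone_dbl i).inr_desc _ _ _

theorem inr_pair_assoc (F G : cone (cone A) ⟶ X) (h : coneMap i.hom ≫ F = coneMap i.hom ≫ G) {Z : C}
    (k : X ⟶ Z) :
    coneMap (dbl i).inr ≫ pair i F G h ≫ k = G ≫ k := by
  simpa only [Category.assoc] using congrArg (· ≫ k) (inr_pair F G h)

theorem pair_ext {s t : cone (dbl i).pt ⟶ X}
    (h₁ : coneMap (dbl i).inl ≫ s = coneMap (dbl i).inl ≫ t)
    (h₂ : coneMap (dbl i).inr ≫ s = coneMap (dbl i).inr ≫ t) : s = t :=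
  (cone_dbl i).hom_ext h₁ h₂

/-- `m : C²A ⟶ C P{i, i}` is an extension of `κ (ρ (C i) ∪ 1) : Σ^i ⟶ C P{i, i}` relative to `i₁`. -/
structure IsMu (i : Cofib (cone A)) (m : cone (cone A) ⟶ cone (dbl i).pt) : Prop where
  left : coneMap i.hom ≫ m = coneMap i.hom ≫ ρ A ≫ (dbl i).inl ≫ κ _
  right : κ (cone A) ≫ m = (dbl i).inr ≫ κ _

theorem exists_isMu (i : Cofib (cone A)) : ∃ m, IsMu i m := by
  obtain ⟨m, h₁, h₂⟩ := i.exists_next_extension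
    (coneMap i.hom ≫ ρ A ≫ (dbl i).inl ≫ κ _) ((dbl i).inr ≫ κ _) (by
      rw [κ_nat_assoc, κ_ρ_assoc, ← Category.assoc, (dbl i).w, Category.assoc])
  exact ⟨m, h₁, h₂⟩

/-- A choice of `μ`. -/
noncomputable def mu (i : Cofib (cone A)) : cone (cone A) ⟶ cone (dbl i).pt := (exists_isMu i).choose

theorem mu_isMu (i : Cofib (cone A)) : IsMu i (mu i) := (exists_isMu i).choose_spec

/-- `{F, G} μ`, a homotopy from `f₁` to `f₂`, for homotopies `F` from `f₀` to `f₁` and `G` from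
`f₀` to `f₂`. -/
noncomputable def diff {f₀ f₁ f₂ : cone A ⟶ X} (F : Htpy i f₀ f₁) (G : Htpy i f₀ f₂) :
    Htpy i f₁ f₂ where
  hom := mu i ≫ pair i F.hom G.hom (F.left.trans G.left.symm)
  left := by
    rw [← Category.assoc, (mu_isMu i).left]
    simp only [Category.assoc]
    rw [← κ_nat_assoc, inl_pair, F.right]
  right := by
    rw [← Category.assoc, (mu_isMu i).right]
    simp only [Category.assoc]
    rw [← κ_nat_assoc, inr_pair, G.right]

/-- The constant homotopy `f ρ`. -/
def const (i : Cofib (cone A)) (f : cone A ⟶ X) : Htpy i f f where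
  hom := ρ A ≫ f
  left := rfl
  right := by rw [κ_ρ_assoc]

/-- The reverse homotopy `{F, f₀ ρ} μ`. -/
noncomputable def bar {f₀ f₁ : cone A ⟶ X} (F : Htpy i f₀ f₁) : Htpy i f₁ f₀ := diff F (const i f₀)

/-- The composite homotopy `F * G = {F̄, G} μ`. -/
noncomputable def star {f₀ f₁ f₂ : cone A ⟶ X} (F : Htpy i f₀ f₁) (G : Htpy i f₁ f₂) :
    Htpy i f₀ f₂ := diff (bar F) G

/-- Homotopy relative to `i₁` of homotopies relative to `i`. -/
instance setoid (i : Cofib (cone A)) (f₀ f₁ : cone A ⟶ X) : Setoid (Htpy i f₀ f₁) where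
  r F G := Nonempty (Htpy i.next F.hom G.hom)
  iseqv := ⟨fun _ => ⟨const _ _⟩, fun ⟨H⟩ => ⟨bar H⟩, fun ⟨H⟩ ⟨K⟩ => ⟨star H K⟩⟩

theorem homotopic_of_agree (j : Cofib (cone A)) {Z : C} {a b : cone A ⟶ cone Z}
    (h : j.hom ≫ a = j.hom ≫ b) (g : cone Z ⟶ X) : Nonempty (Htpy j (a ≫ g) (b ≫ g)) := by
  obtain ⟨K, h₁, h₂⟩ := j.exists_next_extension (coneMap j.hom ≫ ρ A ≫ a) b
    (by rw [κ_nat_assoc, κ_ρ_assoc, h])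
  exact ⟨K ≫ g, by rw [reassoc_of% h₁], by rw [reassoc_of% h₂]⟩

theorem agree_of_isMu {m m' : cone (cone A) ⟶ cone (dbl i).pt} (h : IsMu i m) (h' : IsMu i m') :
    i.next.hom ≫ m = i.next.hom ≫ m' :=
  i.next_ext (h.left.trans h'.left.symm) (h.right.trans h'.right.symm)

/-- The main homotopy: two ends of a pair of double homotopies. -/
theorem diff_homotopic {f₀ f₁ f₂ : cone A ⟶ X} {F : Htpy i f₀ f₁} {G : Htpy i f₀ f₂}
    (U V : cone (cone (cone A)) ⟶ X)
    (h : coneMap (coneMap i.hom) ≫ U = coneMap (coneMap i.hom) ≫ V)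
    (hU : coneMap (κ (cone A)) ≫ U = F.hom) (hV : coneMap (κ (cone A)) ≫ V = G.hom)
    {g₀ : cone A ⟶ X} {F' : Htpy i g₀ f₁} {G' : Htpy i g₀ f₂}
    (hU' : κ _ ≫ U = F'.hom) (hV' : κ _ ≫ V = G'.hom) : diff F G ≈ diff F' G' := by
  have sq2 : IsPushout (coneMap (coneMap i.hom)) (coneMap (coneMap i.hom))
    (coneMap (coneMap (dbl i).inl)) (coneMap (coneMap (dbl i).inr)) :=
    NaturalCone.cone_isPushout i.coneCofib.isCof (cone_dbl i)
  let W := sq2.desc U V h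
  have hWl : coneMap (coneMap (dbl i).inl) ≫ W = U := sq2.inl_desc _ _ _
  have hWr : coneMap (coneMap (dbl i).inr) ≫ W = V := sq2.inr_desc _ _ _
  have hag : i.next.hom ≫ mu i ≫ coneMap (κ _) = i.next.hom ≫ mu i ≫ κ _ := by
    apply i.next_ext
    · rw [← Category.assoc, ← Category.assoc, (mu_isMu i).left]
      simp only [Category.assoc, κ_nat]
    · rw [← Category.assoc, ← Category.assoc, (mu_isMu i).right]
      simp only [Category.assoc, κ_nat]
  obtain ⟨H⟩ := homotopic_of_agree i.next hag W
  have e1 : (mu i ≫ coneMap (κ _)) ≫ W = (diff F G).hom := by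
    rw [Category.assoc]
    refine congrArg (mu i ≫ ·) (pair_ext ?_ ?_)
    · rw [inl_pair, coneMap_sq_assoc (κ_nat (dbl i).inl).symm, hWl, hU]
    · rw [inr_pair, coneMap_sq_assoc (κ_nat (dbl i).inr).symm, hWr, hV]
  have e2 : (mu i ≫ κ _) ≫ W = (diff F' G').hom := by
    rw [Category.assoc]
    refine congrArg (mu i ≫ ·) (pair_ext ?_ ?_)
    · rw [inl_pair, ← κ_nat_assoc, hWl, hU']
    · rw [inr_pair, ← κ_nat_assoc, hWr, hV']
  rw [e1, e2] at H
  exact ⟨H⟩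

theorem diff_congr {f₀ f₁ f₂ : cone A ⟶ X} {F F' : Htpy i f₀ f₁} {G G' : Htpy i f₀ f₂}
    (hF : F ≈ F') (hG : G ≈ G') : diff F G ≈ diff F' G' := by
  obtain ⟨U⟩ := hF
  obtain ⟨V⟩ := hG
  have key : ∀ {f : cone A ⟶ X} {F F' : Htpy i f₀ f} (U : Htpy i.next F.hom F'.hom),
      coneMap (coneMap i.hom) ≫ U.hom = coneMap (coneMap i.hom) ≫ ρ _ ≫ ρ _ ≫ f₀ ∧
      coneMap (κ (cone A)) ≫ U.hom = F.hom := by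
    intro f F F' U
    have h := U.left
    constructor
    · have h1 := congrArg (coneMap i.nextInl ≫ ·) h
      simp only [i.cone_inl_next_assoc] at h1
      rw [h1, ← ρ_nat_assoc, F.left, ρ_nat_assoc]
    · have h1 := congrArg (coneMap i.nextInr ≫ ·) h
      simp only [i.cone_inr_next_assoc] at h1
      rw [h1, coneκ_ρ_assoc]
  exact diff_homotopic U.hom V.hom ((key U).1.trans (key V).1.symm) (key U).2 (key V).2
    U.right V.right

theorem const_diff {f₀ f₁ : cone A ⟶ X} (G : Htpy i f₀ f₁) : diff (const i f₀) G ≈ G := by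
  refine Setoid.symm ⟨⟨coneMap (mu i) ≫ ρ _ ≫
    pair i (const i f₀).hom G.hom ((const i f₀).left.trans G.left.symm), ?_, ?_⟩⟩
  · apply i.cone_next_ext
    · rw [coneMap_sq_assoc (mu_isMu i).left, coneMap_comp, coneMap_comp]
      simp only [Category.assoc, coneκ_ρ_assoc, inl_pair]
      rw [← ρ_nat_assoc, G.left]
      simp only [const, ← ρ_ρ_assoc, ρ_nat_assoc]
    · rw [coneMap_sq_assoc (mu_isMu i).right, coneκ_ρ_assoc, coneκ_ρ_assoc, inr_pair]
  · rw [κ_nat_assoc, κ_ρ_assoc]; rfl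

theorem diff_self {f₀ f₁ : cone A ⟶ X} (F : Htpy i f₀ f₁) : diff F F ≈ const i f₁ := by
  let N : (dbl i).pt ⟶ cone A := (dbl i).desc (𝟙 _) (𝟙 _) rfl
  have hag : i.next.hom ≫ mu i ≫ coneMap N = i.next.hom ≫ ρ A ≫ κ _ := by
    apply i.next_ext
    · rw [← Category.assoc, (mu_isMu i).left]
      simp only [Category.assoc, κ_nat, N, (dbl i).inl_desc_assoc, Category.id_comp]
    · rw [← Category.assoc, (mu_isMu i).right]
      simp only [Category.assoc, κ_nat, N, (dbl i).inr_desc_assoc, Category.id_comp, κ_ρ_assoc]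
  obtain ⟨H⟩ := homotopic_of_agree i.next hag F.hom
  have e1 : (mu i ≫ coneMap N) ≫ F.hom = (diff F F).hom := by
    rw [Category.assoc]
    refine congrArg (mu i ≫ ·) (pair_ext ?_ ?_)
    · rw [inl_pair, ← Category.assoc, ← coneMap_comp, (dbl i).inl_desc, coneMap_id,
        Category.id_comp]
    · rw [inr_pair, ← Category.assoc, ← coneMap_comp, (dbl i).inr_desc, coneMap_id,
        Category.id_comp]
  have e2 : (ρ A ≫ κ _) ≫ F.hom = (const i f₁).hom := by
    rw [Category.assoc, F.right]; rfl
  rw [e1, e2] at H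
  exact ⟨H⟩

theorem diff_diff {f₀ f₁ f₂ f₃ : cone A ⟶ X} (E : Htpy i f₀ f₁) (F : Htpy i f₀ f₂)
    (G : Htpy i f₀ f₃) : diff (diff E F) (diff E G) ≈ diff F G := by
  have key : ∀ {f : cone A ⟶ X} (F : Htpy i f₀ f),
      coneMap (coneMap i.hom) ≫ coneMap (mu i) ≫ ρ _ ≫ pair i E.hom F.hom
        (E.left.trans F.left.symm) = coneMap (coneMap i.hom) ≫ coneMap (ρ A) ≫ E.hom ∧
      coneMap (κ (cone A)) ≫ coneMap (mu i) ≫ ρ _ ≫ pair i E.hom F.hom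
        (E.left.trans F.left.symm) = F.hom := by
    intro f F
    constructor
    · rw [coneMap_sq_assoc (mu_isMu i).left, coneMap_comp, coneMap_comp]
      simp only [Category.assoc, coneκ_ρ_assoc, inl_pair]
    · rw [coneMap_sq_assoc (mu_isMu i).right, coneκ_ρ_assoc, inr_pair]
  refine Setoid.symm (diff_homotopic _ _ ((key F).1.trans (key G).1.symm) (key F).2 (key G).2 ?_ ?_)
  · rw [κ_nat_assoc, κ_ρ_assoc]; rfl
  · rw [κ_nat_assoc, κ_ρ_assoc]; rfl

end Htpy


namespace Htpy

variable {A X : C} {i : Cofib (cone A)}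

theorem homotopic_diff {f₀ f₁ f₂ : cone A ⟶ X} {F : Htpy i f₀ f₁} {G : Htpy i f₀ f₂}
    {m : cone (cone A) ⟶ cone (dbl i).pt} (hm : IsMu i m) {p : cone (dbl i).pt ⟶ X}
    (h₁ : coneMap (dbl i).inl ≫ p = F.hom) (h₂ : coneMap (dbl i).inr ≫ p = G.hom)
    {K : Htpy i f₁ f₂} (hK : K.hom = m ≫ p) : K ≈ diff F G := by
  have e : p = pair i F.hom G.hom (F.left.trans G.left.symm) :=
    pair_ext (by rw [h₁, inl_pair]) (by rw [h₂, inr_pair])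
  obtain ⟨H⟩ := homotopic_of_agree i.next (agree_of_isMu hm (mu_isMu i)) p
  subst e
  exact ⟨by rw [hK]; exact H⟩

end Htpy

/-- The homotopy bracket `H_i(f₀, f₁) = [C²A, X]^{{f₀ ρ (C i), f₁}(i₁)}`. -/
def HBracket {A X : C} (i : Cofib (cone A)) (f₀ f₁ : cone A ⟶ X) : Type v :=
  Quotient (Htpy.setoid i f₀ f₁)

namespace HBracket

variable {A X : C} {i : Cofib (cone A)}

/-- The class of a homotopy. -/
def mk {f₀ f₁ : cone A ⟶ X} (F : Htpy i f₀ f₁) : HBracket i f₀ f₁ := Quotient.mk _ F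

theorem sound {f₀ f₁ : cone A ⟶ X} {F G : Htpy i f₀ f₁} (h : F ≈ G) : mk F = mk G := Quotient.sound h

theorem exact {f₀ f₁ : cone A ⟶ X} {F G : Htpy i f₀ f₁} (h : mk F = mk G) : F ≈ G := Quotient.exact h

/-- `[{F, G} μ]`. -/
noncomputable def diff {f₀ f₁ f₂ : cone A ⟶ X} (a : HBracket i f₀ f₁) (b : HBracket i f₀ f₂) :
    HBracket i f₁ f₂ :=
  Quotient.map₂ Htpy.diff (fun _ _ h _ _ h' => Htpy.diff_congr h h') a b

theorem diff_mk {f₀ f₁ f₂ : cone A ⟶ X} (F : Htpy i f₀ f₁) (G : Htpy i f₀ f₂) :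
    diff (mk F) (mk G) = mk (F.diff G) := rfl

theorem one_diff {f₀ f₁ : cone A ⟶ X} (b : HBracket i f₀ f₁) :
    diff (mk (Htpy.const i f₀)) b = b := by
  induction b using Quotient.inductionOn
  exact Quotient.sound (Htpy.const_diff _)

theorem diff_self {f₀ f₁ : cone A ⟶ X} (b : HBracket i f₀ f₁) :
    diff b b = mk (Htpy.const i f₁) := by
  induction b using Quotient.inductionOn
  exact Quotient.sound (Htpy.diff_self _)

theorem diff_diff {f₀ f₁ f₂ f₃ : cone A ⟶ X} (a : HBracket i f₀ f₁) (b : HBracket i f₀ f₂)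
    (c : HBracket i f₀ f₃) : diff (diff a b) (diff a c) = diff b c := by
  induction a using Quotient.inductionOn
  induction b using Quotient.inductionOn
  induction c using Quotient.inductionOn
  exact Quotient.sound (Htpy.diff_diff _ _ _)

/-- The vertex groups of the homotopy groupoid, with `[F] [G] = [F * G]`, `1 = [h ρ]` and
`[F]⁻¹ = [F̄]`. -/
noncomputable instance (h : cone A ⟶ X) : Group (HBracket i h h) where
  mul := Quotient.map₂ Htpy.star
    (fun _ _ h _ _ h' => Htpy.diff_congr (Htpy.diff_congr h (Setoid.refl _)) h')
  one := mk (Htpy.const i h)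
  inv := Quotient.map Htpy.bar (fun _ _ h => Htpy.diff_congr h (Setoid.refl _))
  mul_assoc a b c := by
    induction a using Quotient.inductionOn with | _ F
    induction b using Quotient.inductionOn with | _ G
    induction c using Quotient.inductionOn with | _ H
    change diff (diff (diff (diff (mk F) (mk (Htpy.const i h))) (mk G)) (mk (Htpy.const i h)))
      (mk H) = diff (diff (mk F) (mk (Htpy.const i h))) (diff (diff (mk G) (mk (Htpy.const i h)))
        (mk H))
    generalize mk F = a, mk G = b, mk H = c
    generalize ho : mk (Htpy.const i h) = o
    have h1 : ∀ x : HBracket i h h, diff o x = x := fun x => ho ▸ one_diff x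
    have hs : ∀ x : HBracket i h h, diff x x = o := fun x => ho ▸ diff_self x
    have e3 : diff (diff b o) o = b := by
      have := diff_diff b o b
      rwa [hs, h1] at this
    have e : diff (diff (diff a o) b) o = diff b (diff a o) := by
      have := diff_diff (diff a o) b (diff a o)
      rwa [hs] at this
    have e2 : c = diff b (diff (diff b o) c) := by
      have := diff_diff (diff b o) o c
      rw [h1, e3] at this
      exact this.symm
    rw [e]
    conv_lhs => rw [e2]
    rw [diff_diff]
  one_mul b := by
    change diff (diff (mk (Htpy.const i h)) (mk (Htpy.const i h))) b = b
    rw [one_diff, one_diff]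
  mul_one a := by
    induction a using Quotient.inductionOn with | _ F
    change diff (diff (mk F) (mk (Htpy.const i h))) (mk (Htpy.const i h)) = mk F
    conv_lhs => rw [← diff_self (mk F)]
    rw [diff_diff, diff_self, one_diff]
  inv_mul_cancel a := by
    induction a using Quotient.inductionOn with | _ F
    change diff (diff (diff (mk F) (mk (Htpy.const i h))) (mk (Htpy.const i h))) (mk F) =
      mk (Htpy.const i h)
    have e3 : diff (diff (mk F) (mk (Htpy.const i h))) (mk (Htpy.const i h)) = mk F := by
      conv_lhs => rw [← diff_self (mk F)]
      rw [diff_diff, diff_self, one_diff]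
    rw [e3, diff_self]

theorem mk_mul {h : cone A ⟶ X} (F G : Htpy i h h) : mk F * mk G = mk (F.star G) := rfl

theorem one_def (h : cone A ⟶ X) : (1 : HBracket i h h) = mk (Htpy.const i h) := rfl

/-- The homomorphism induced by a map of homotopies that is compatible with `{-, -} μ`. -/
def homOf {D : Type w} [Category.{v'} D] [NaturalCone D] {A' X' : D} {j : Cofib (cone A')}
    {h : cone A ⟶ X} {h' : cone A' ⟶ X'} (Φ : Htpy i h h → Htpy j h' h')
    (hΦ : ∀ F G, F ≈ G → Φ F ≈ Φ G) (h₁ : Φ (Htpy.const i h) = Htpy.const j h')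
    (hd : ∀ F G, Φ (F.diff G) ≈ (Φ F).diff (Φ G)) : HBracket i h h →* HBracket j h' h' where
  toFun := Quotient.map Φ hΦ
  map_one' := Quotient.sound (by rw [h₁])
  map_mul' a b := by
    induction a using Quotient.inductionOn with | _ F
    induction b using Quotient.inductionOn with | _ G
    refine Quotient.sound (Setoid.trans (hd _ _) (Htpy.diff_congr (Setoid.trans (hd _ _) ?_)
      (Setoid.refl _)))
    rw [h₁]; exact Setoid.refl _

end HBracket

/-- A cofibration `i : B ⟶ C A` together with a base morphism `h : C A ⟶ X`. -/
structure Based (X : C) where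
  A : C
  i : Cofib (cone A)
  h : cone A ⟶ X

/-- The passage from `(i, h)` to `(i₁, h ρ)`. -/
def Based.shift {X : C} (b : Based X) : Based X := ⟨cone b.A, b.i.next, ρ b.A ≫ b.h⟩

/-- For `b = (i, h)`, the homotopy group `π_{n+1}^i(X, h) = H_{i_n}(h ρⁿ, h ρⁿ)`. -/
def HGroup {X : C} (b : Based X) (n : ℕ) : Type v :=
  HBracket (Based.shift^[n] b).i (Based.shift^[n] b).h (Based.shift^[n] b).h

noncomputable instance {X : C} (b : Based X) (n : ℕ) : Group (HGroup b n) :=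
  inferInstanceAs (Group (HBracket _ _ _))

/-- The action of a morphism `g : X ⟶ X'` on homotopies, `F ↦ g F`. -/
def Htpy.push {A X X' : C} {i : Cofib (cone A)} {h : cone A ⟶ X} {h' : cone A ⟶ X'} (g : X ⟶ X')
    (w : h ≫ g = h') (F : Htpy i h h) : Htpy i h' h' where
  hom := F.hom ≫ g
  left := by rw [← Category.assoc, F.left, ← w]; simp only [Category.assoc]
  right := by rw [← Category.assoc, F.right, w]

/-- The homomorphism `[F] ↦ [g F]`. -/
def HBracket.push {A X X' : C} (g : X ⟶ X') (i : Cofib (cone A)) (h : cone A ⟶ X)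
    (h' : cone A ⟶ X') (w : h ≫ g = h') : HBracket i h h →* HBracket i h' h' :=
  HBracket.homOf (Htpy.push g w)
    (by
      rintro F G ⟨H⟩
      refine ⟨H.hom ≫ g, ?_, ?_⟩
      · rw [← Category.assoc, H.left]; simp only [Htpy.push, Category.assoc]
      · rw [← Category.assoc, H.right]; rfl)
    (by ext; simp only [Htpy.push, Htpy.const, Category.assoc, w])
    (fun F G => Htpy.homotopic_diff (Htpy.mu_isMu i)
      (p := Htpy.pair i F.hom G.hom (F.left.trans G.left.symm) ≫ g)
      (by rw [Htpy.inl_pair_assoc]; rfl) (by rw [Htpy.inr_pair_assoc]; rfl)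
      (by simp only [Htpy.push, Htpy.diff, Category.assoc]))

/-- The homomorphism `g_* : π_{n+1}^i(X, h) ⟶ π_{n+1}^i(X', g h)`, `[F] ↦ [g F]`. -/
def HGroup.push {X X' : C} (g : X ⟶ X') : (n : ℕ) → {A : C} → (i : Cofib (cone A)) →
    (h : cone A ⟶ X) → (h' : cone A ⟶ X') → h ≫ g = h' → (HGroup ⟨A, i, h⟩ n →* HGroup ⟨A, i, h'⟩ n)
  | 0, _, i, h, h', w => HBracket.push g i h h' w
  | n + 1, A, i, h, h', w => HGroup.push g n i.next (ρ A ≫ h) (ρ A ≫ h')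
      (by rw [Category.assoc, w])

/-- The square `(C g) i₁ = j₁ k₁` induced by a square `g i = j k`. -/
theorem Cofib.next_sq {A A' : C} {i : Cofib A} {j : Cofib A'} {g : A ⟶ A'}
    (sq : ∃ k, i.hom ≫ g = k ≫ j.hom) : ∃ k, i.next.hom ≫ coneMap g = k ≫ j.next.hom := by
  obtain ⟨k, sq⟩ := sq
  refine ⟨i.next_isPushout.desc (coneMap k ≫ j.nextInl) (g ≫ j.nextInr)
    (by rw [κ_nat_assoc, reassoc_of% sq, j.next_isPushout.w]), i.next_isPushout.hom_ext ?_ ?_⟩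
  · rw [i.inl_next_assoc, IsPushout.inl_desc_assoc, Category.assoc, j.inl_next, coneMap_sq sq]
  · rw [i.inr_next_assoc, IsPushout.inr_desc_assoc, Category.assoc, j.inr_next, κ_nat]

/-- For a commutative square `(C g) i = j k`, the map `F ↦ F (C²g)`. -/
def Htpy.pull {A A' X : C} {i : Cofib (cone A)} {j : Cofib (cone A')} {h : cone A' ⟶ X}
    {h' : cone A ⟶ X} (g : A ⟶ A') (sq : ∃ k, i.hom ≫ coneMap g = k ≫ j.hom)
    (w : coneMap g ≫ h = h') (F : Htpy j h h) : Htpy i h' h' where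
  hom := coneMap (coneMap g) ≫ F.hom
  left := by
    obtain ⟨k, sq⟩ := sq
    rw [coneMap_sq_assoc sq, F.left, ← w, ← coneMap_sq_assoc sq, ρ_nat_assoc]
  right := by rw [κ_nat_assoc, F.right, w]

/-- The homomorphism `[F] ↦ [F (C²g)]` of a commutative square `(C g) i = j k`. -/
def HBracket.pull {A A' X : C} (g : A ⟶ A') (i : Cofib (cone A)) (j : Cofib (cone A'))
    (sq : ∃ k, i.hom ≫ coneMap g = k ≫ j.hom) (h : cone A' ⟶ X) (h' : cone A ⟶ X)
    (w : coneMap g ≫ h = h') : HBracket j h h →* HBracket i h' h' :=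
  HBracket.homOf (Htpy.pull g sq w)
    (by
      rintro F G ⟨H⟩
      obtain ⟨k, sq'⟩ := Cofib.next_sq sq
      refine ⟨coneMap (coneMap (coneMap g)) ≫ H.hom, ?_, ?_⟩
      · rw [coneMap_sq_assoc sq', H.left, ← coneMap_sq_assoc sq', ← ρ_nat_assoc]; rfl
      · rw [κ_nat_assoc, H.right]; rfl)
    (by ext; simp only [Htpy.pull, Htpy.const, ← w, ρ_nat_assoc])
    (by
      intro F G
      obtain ⟨k, sq'⟩ := sq
      let D : (Htpy.dbl i).pt ⟶ (Htpy.dbl j).pt := (Htpy.dbl i).desc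
        (coneMap g ≫ (Htpy.dbl j).inl) (coneMap g ≫ (Htpy.dbl j).inr)
        (by rw [reassoc_of% sq', reassoc_of% sq', (Htpy.dbl j).w])
      have hDl : (Htpy.dbl i).inl ≫ D = coneMap g ≫ (Htpy.dbl j).inl :=
        (Htpy.dbl i).inl_desc _ _ _
      have hDr : (Htpy.dbl i).inr ≫ D = coneMap g ≫ (Htpy.dbl j).inr :=
        (Htpy.dbl i).inr_desc _ _ _
      have hag : i.next.hom ≫ coneMap (coneMap g) ≫ Htpy.mu j =
          i.next.hom ≫ Htpy.mu i ≫ coneMap D := by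
        apply i.next_ext
        · rw [coneMap_sq_assoc sq', (Htpy.mu_isMu j).left, ← Category.assoc (coneMap i.hom),
            (Htpy.mu_isMu i).left]
          simp only [Category.assoc, κ_nat, reassoc_of% hDl]
          rw [← coneMap_sq_assoc sq', ρ_nat_assoc]
        · rw [κ_nat_assoc, (Htpy.mu_isMu j).right, ← Category.assoc (κ _),
            (Htpy.mu_isMu i).right]
          simp only [Category.assoc, κ_nat, reassoc_of% hDr]
      obtain ⟨H⟩ := Htpy.homotopic_of_agree i.next hag
        (Htpy.pair j F.hom G.hom (F.left.trans G.left.symm))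
      have e : (Htpy.mu i ≫ coneMap D) ≫ Htpy.pair j F.hom G.hom (F.left.trans G.left.symm) =
          ((Htpy.pull g ⟨k, sq'⟩ w F).diff (Htpy.pull g ⟨k, sq'⟩ w G)).hom := by
        rw [Category.assoc]
        refine congrArg (Htpy.mu i ≫ ·) (Htpy.pair_ext ?_ ?_)
        · rw [Htpy.inl_pair, coneMap_sq_assoc hDl, Htpy.inl_pair]; rfl
        · rw [Htpy.inr_pair, coneMap_sq_assoc hDr, Htpy.inr_pair]; rfl
      rw [e, Category.assoc] at H
      exact ⟨H⟩)

/-- The homomorphism `(C^{n+1}g)^* : π_{n+1}^j(X, h) ⟶ π_{n+1}^i(X, h (C g))`,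
`[F] ↦ [F (C^{n+2}g)]`, of a commutative square `(C g) i = j k`. -/
def HGroup.pull {X : C} : (n : ℕ) → {A A' : C} → (g : A ⟶ A') → (i : Cofib (cone A)) →
    (j : Cofib (cone A')) → (∃ k, i.hom ≫ coneMap g = k ≫ j.hom) → (h : cone A' ⟶ X) →
    (h' : cone A ⟶ X) → coneMap g ≫ h = h' → (HGroup ⟨A', j, h⟩ n →* HGroup ⟨A, i, h'⟩ n)
  | 0, _, _, g, i, j, sq, h, h', w => HBracket.pull g i j sq h h' w
  | n + 1, A, A', g, i, j, sq, h, h', w =>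
      HGroup.pull n (coneMap g) i.next j.next (Cofib.next_sq sq) (ρ A' ≫ h) (ρ A ≫ h')
        (by rw [← ρ_nat_assoc, w])

/-- For a cofibration `i : B ⟶ A` and `h : C A ⟶ X`, the homotopy group
`π_{n+2}^i(X, h) = π_{n+1}^{i₁}(X, h)`. -/
abbrev RelGroup {A X : C} (i : Cofib A) (h : cone A ⟶ X) (n : ℕ) : Type v := HGroup ⟨A, i.next, h⟩ n

end Basic

section Pairs

variable {C : Type u} [Category.{v} C] [NaturalCone C]

theorem isCof_of_isIso {X Y : C} (e : X ⟶ Y) [IsIso e] : IsCof e :=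
  NaturalCone.cof_of_isPushout (NaturalCone.cof_id X)
    (IsPushout.of_vert_isIso (f := 𝟙 X) (g := 𝟙 X) (inl := e) (inr := e) ⟨by simp⟩)

end Pairs

/-- A pair `(X, Y)`: a cofibration `f : Y ⟶ X`. -/
structure CofPair (C : Type u) [Category.{v} C] [NaturalCone C] where
  fst : C
  snd : C
  map : snd ⟶ fst
  isCof : IsCof map

section Pairs

variable {C : Type u} [Category.{v} C] [NaturalCone C]

namespace CofPair

/-- A morphism of pairs from `(X, Y)` to `(X', Y')`: a pair `(g, h)` with `g f = f' h`. -/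
@[ext]
structure Hom (P Q : CofPair C) where
  fst : P.fst ⟶ Q.fst
  snd : P.snd ⟶ Q.snd
  w : P.map ≫ fst = snd ≫ Q.map

instance : Category.{v} (CofPair C) where
  Hom := Hom
  id P := ⟨𝟙 _, 𝟙 _, by simp⟩
  comp a b := ⟨a.fst ≫ b.fst, a.snd ≫ b.snd, by
    rw [← Category.assoc, a.w, Category.assoc, b.w, Category.assoc]⟩

@[ext]
theorem hom_ext {P Q : CofPair C} {a b : P ⟶ Q} (h₁ : a.fst = b.fst) (h₂ : a.snd = b.snd) : a = b :=
  Hom.ext h₁ h₂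

@[simp] theorem comp_fst {P Q R : CofPair C} (a : P ⟶ Q) (b : Q ⟶ R) :
    (a ≫ b).fst = a.fst ≫ b.fst := rfl
@[simp] theorem comp_snd {P Q R : CofPair C} (a : P ⟶ Q) (b : Q ⟶ R) :
    (a ≫ b).snd = a.snd ≫ b.snd := rfl
@[simp] theorem id_fst (P : CofPair C) : Hom.fst (𝟙 P) = 𝟙 P.fst := rfl
@[simp] theorem id_snd (P : CofPair C) : Hom.snd (𝟙 P) = 𝟙 P.snd := rfl

/-- The cone of pairs, `C(X, Y) = (C X, C Y)`, `κ = (κ, κ)`, `ρ = (ρ, ρ)`. -/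
def monad : Monad (CofPair C) where
  obj P := ⟨cone P.fst, cone P.snd, coneMap P.map, (Cofib.coneCofib ⟨_, P.map, P.isCof⟩).isCof⟩
  map a := ⟨coneMap a.fst, coneMap a.snd, coneMap_sq a.w⟩
  map_id _ := hom_ext (coneMap_id _) (coneMap_id _)
  map_comp _ _ := hom_ext (coneMap_comp _ _) (coneMap_comp _ _)
  η :=
    { app P := ⟨κ P.fst, κ P.snd, (κ_nat _).symm⟩
      naturality _ _ _ := hom_ext (κ_nat _).symm (κ_nat _).symm }
  μ :=
    { app P := ⟨ρ P.fst, ρ P.snd, (ρ_nat _).symm⟩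
      naturality _ _ _ := hom_ext (ρ_nat _).symm (ρ_nat _).symm }
  assoc _ := hom_ext (ρ_ρ _).symm (ρ_ρ _).symm
  left_unit _ := hom_ext (κ_ρ _) (κ_ρ _)
  right_unit _ := hom_ext (coneκ_ρ _) (coneκ_ρ _)

/-- The cofibrations of pairs: the `(u, v) : (X, Y) ⟶ (X', Y')` for which `v` and
`{f', u} : P{v, f} ⟶ X'` are cofibrations. -/
def cof : MorphismProperty (CofPair C) := fun P Q a =>
  ∃ hv : IsCof a.snd, IsCof ((NaturalCone.po a.snd P.map hv).desc Q.map a.fst a.w.symm)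

theorem cof_iff {P Q : CofPair C} (a : P ⟶ Q) {N : C} {l : Q.snd ⟶ N} {r : P.fst ⟶ N}
    (sq : IsPushout a.snd P.map l r) {n : N ⟶ Q.fst} (h₁ : l ≫ n = Q.map) (h₂ : r ≫ n = a.fst) :
    cof a ↔ IsCof a.snd ∧ IsCof n := by
  constructor
  · rintro ⟨hv, h⟩
    refine ⟨hv, ?_⟩
    have e : n = (sq.isoIsPushout _ _ (NaturalCone.po a.snd P.map hv).isPushout).hom ≫
        (NaturalCone.po a.snd P.map hv).desc Q.map a.fst a.w.symm := by
      apply sq.hom_ext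
      · rw [IsPushout.inl_isoIsPushout_hom_assoc, PushoutSquare.inl_desc, h₁]
      · rw [IsPushout.inr_isoIsPushout_hom_assoc, PushoutSquare.inr_desc, h₂]
    rw [e]
    exact NaturalCone.cof_comp _ _ (isCof_of_isIso _) h
  · rintro ⟨hv, h⟩
    refine ⟨hv, ?_⟩
    have e : (NaturalCone.po a.snd P.map hv).desc Q.map a.fst a.w.symm =
        (sq.isoIsPushout _ _ (NaturalCone.po a.snd P.map hv).isPushout).inv ≫ n := by
      apply PushoutSquare.hom_ext
      · rw [IsPushout.inl_isoIsPushout_inv_assoc, PushoutSquare.inl_desc, h₁]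
      · rw [IsPushout.inr_isoIsPushout_inv_assoc, PushoutSquare.inr_desc, h₂]
    rw [e]
    exact NaturalCone.cof_comp _ _ (isCof_of_isIso _) h

theorem cof.snd {P Q : CofPair C} {a : P ⟶ Q} (h : cof a) : IsCof a.snd := h.1

theorem cof.fst {P Q : CofPair C} {a : P ⟶ Q} (h : cof a) : IsCof a.fst := by
  obtain ⟨hv, h⟩ := h
  rw [← (NaturalCone.po a.snd P.map hv).inr_desc Q.map a.fst a.w.symm]
  exact NaturalCone.cof_comp _ _
    (NaturalCone.cof_of_isPushout hv (NaturalCone.po a.snd P.map hv).isPushout) h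

theorem isPushout_of {A B X P : CofPair C} {i : B ⟶ A} {f : B ⟶ X} {f' : A ⟶ P} {i' : X ⟶ P}
    (h₁ : IsPushout i.fst f.fst f'.fst i'.fst) (h₂ : IsPushout i.snd f.snd f'.snd i'.snd) :
    IsPushout i f f' i' :=
  ⟨⟨hom_ext h₁.w h₂.w⟩, ⟨PushoutCocone.IsColimit.mk _
    (fun s => ⟨h₁.desc s.inl.fst s.inr.fst (congrArg Hom.fst s.condition),
      h₂.desc s.inl.snd s.inr.snd (congrArg Hom.snd s.condition), by
        apply h₂.hom_ext
        · rw [← Category.assoc, ← f'.w, Category.assoc, h₁.inl_desc, h₂.inl_desc_assoc, Hom.w]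
        · rw [← Category.assoc, ← i'.w, Category.assoc, h₁.inr_desc, h₂.inr_desc_assoc, Hom.w]⟩)
    (fun s => hom_ext (h₁.inl_desc _ _ _) (h₂.inl_desc _ _ _))
    (fun s => hom_ext (h₁.inr_desc _ _ _) (h₂.inr_desc _ _ _))
    (fun s m e₁ e₂ => hom_ext
      (h₁.hom_ext ((congrArg Hom.fst e₁).trans (h₁.inl_desc _ _ _).symm)
        ((congrArg Hom.fst e₂).trans (h₁.inr_desc _ _ _).symm))
      (h₂.hom_ext ((congrArg Hom.snd e₁).trans (h₂.inl_desc _ _ _).symm)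
        ((congrArg Hom.snd e₂).trans (h₂.inr_desc _ _ _).symm)))⟩⟩

/-- The comparison of the corner maps `P{v, b} ⟶ A` in a pushout of pairs. -/
theorem corner_isPushout {C : Type u} [Category.{v} C] {A₁ A₂ B₁ B₂ X₁ X₂ P₁ P₂ N M : C} {a : A₂ ⟶ A₁} {b : B₂ ⟶ B₁} {x : X₂ ⟶ X₁}
    {p : P₂ ⟶ P₁} {u : B₁ ⟶ A₁} {v : B₂ ⟶ A₂} {f₁ : B₁ ⟶ X₁} {f₂ : B₂ ⟶ X₂} {g₁ : A₁ ⟶ P₁}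
    {g₂ : A₂ ⟶ P₂} {s₁ : X₁ ⟶ P₁} {s₂ : X₂ ⟶ P₂} (hf : b ≫ f₁ = f₂ ≫ x)
    (hg : a ≫ g₁ = g₂ ≫ p)
    (h₁ : IsPushout u f₁ g₁ s₁) (h₂ : IsPushout v f₂ g₂ s₂)
    {nl : A₂ ⟶ N} {nr : B₁ ⟶ N} (hN : IsPushout v b nl nr) {n : N ⟶ A₁} (hnl : nl ≫ n = a)
    (hnr : nr ≫ n = u) {ml : P₂ ⟶ M} {mr : X₁ ⟶ M} (hM : IsPushout s₂ x ml mr) {m : M ⟶ P₁}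
    (hml : ml ≫ m = p) (hmr : mr ≫ m = s₁) :
    ∃ c : N ⟶ M, IsPushout n c g₁ m := by
  have hout : IsPushout (b ≫ f₁) v mr (g₂ ≫ ml) := by
    rw [hf]; exact h₂.flip.paste_horiz hM.flip
  have hc : v ≫ g₂ ≫ ml = b ≫ f₁ ≫ mr := by
    rw [← Category.assoc b, hout.w]
  have hl : nl ≫ hN.desc (g₂ ≫ ml) (f₁ ≫ mr) hc = g₂ ≫ ml := hN.inl_desc _ _ _
  have hr : nr ≫ hN.desc (g₂ ≫ ml) (f₁ ≫ mr) hc = f₁ ≫ mr := hN.inr_desc _ _ _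
  refine ⟨hN.desc (g₂ ≫ ml) (f₁ ≫ mr) hc, ?_⟩
  rw [← hl] at hout
  have h3 := IsPushout.of_left hout hr.symm hN.flip
  refine IsPushout.of_left (by rw [hnr, hmr]; exact h₁) (hN.hom_ext ?_ ?_) h3.flip
  · rw [reassoc_of% hnl, reassoc_of% hl, hml, hg]
  · rw [reassoc_of% hnr, reassoc_of% hr, hmr, h₁.w]

/-- Pushouts of pairs along cofibrations, componentwise: the induced morphisms. -/
theorem po_aux {A B X : CofPair C} (i : B ⟶ A) (f : B ⟶ X) (hi : cof i) {P : CofPair C}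
    {f' : A ⟶ P} {i' : X ⟶ P} (h₁ : IsPushout i.fst f.fst f'.fst i'.fst)
    (h₂ : IsPushout i.snd f.snd f'.snd i'.snd) : cof i' := by
  obtain ⟨hv, hn⟩ := hi
  have hs₂ : IsCof i'.snd := NaturalCone.cof_of_isPushout hv h₂
  refine ⟨hs₂, ?_⟩
  obtain ⟨c, hc⟩ := corner_isPushout f.w f'.w h₁ h₂ (NaturalCone.po i.snd B.map hv).isPushout
    (PushoutSquare.inl_desc _ _ _ i.w.symm) (PushoutSquare.inr_desc _ _ _ i.w.symm)
    (NaturalCone.po i'.snd X.map hs₂).isPushout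
    (PushoutSquare.inl_desc _ _ _ i'.w.symm) (PushoutSquare.inr_desc _ _ _ i'.w.symm)
  exact NaturalCone.cof_of_isPushout hn hc

theorem po_cof {A₁ A₂ B₁ B₂ X₁ X₂ P₁ P₂ : C} {a : A₂ ⟶ A₁} {b : B₂ ⟶ B₁} {x : X₂ ⟶ X₁}
    {p : P₂ ⟶ P₁} {u : B₁ ⟶ A₁} {v : B₂ ⟶ A₂} {f₁ : B₁ ⟶ X₁} {f₂ : B₂ ⟶ X₂} {g₁ : A₁ ⟶ P₁}
    {g₂ : A₂ ⟶ P₂} {s₁ : X₁ ⟶ P₁} {s₂ : X₂ ⟶ P₂} (hf : b ≫ f₁ = f₂ ≫ x)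
    (hg : a ≫ g₁ = g₂ ≫ p) (hs : x ≫ s₁ = s₂ ≫ p)
    (h₁ : IsPushout u f₁ g₁ s₁) (h₂ : IsPushout v f₂ g₂ s₂) (hx : IsCof x)
    (hv : IsCof v) (w : b ≫ u = v ≫ a) (hn : IsCof ((NaturalCone.po v b hv).desc a u w.symm)) :
    IsCof p := by
  have hs₂ : IsCof s₂ := NaturalCone.cof_of_isPushout hv h₂
  obtain ⟨c, hc⟩ := corner_isPushout hf hg h₁ h₂ (NaturalCone.po v b hv).isPushout
    (PushoutSquare.inl_desc _ _ _ w.symm) (PushoutSquare.inr_desc _ _ _ w.symm)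
    (NaturalCone.po s₂ x hs₂).isPushout
    (PushoutSquare.inl_desc _ _ _ hs.symm) (PushoutSquare.inr_desc _ _ _ hs.symm)
  rw [← (NaturalCone.po s₂ x hs₂).inl_desc p s₁ hs.symm]
  exact NaturalCone.cof_comp _ _
    (NaturalCone.cof_of_isPushout hx (NaturalCone.po s₂ x hs₂).isPushout.flip)
    (NaturalCone.cof_of_isPushout hn hc)

/-- Pushouts of pairs along cofibrations are computed componentwise. -/
def po {A B X : CofPair C} (i : B ⟶ A) (f : B ⟶ X) (hi : cof i) : PushoutSquare i f where
  pt :=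
    { fst := (NaturalCone.po i.fst f.fst hi.fst).pt
      snd := (NaturalCone.po i.snd f.snd hi.snd).pt
      map := (NaturalCone.po i.snd f.snd hi.snd).desc
        (A.map ≫ (NaturalCone.po i.fst f.fst hi.fst).inl)
        (X.map ≫ (NaturalCone.po i.fst f.fst hi.fst).inr) (by
          rw [← Category.assoc, ← i.w, Category.assoc, (NaturalCone.po i.fst f.fst hi.fst).w,
            ← Category.assoc, f.w, Category.assoc])
      isCof := po_cof f.w (PushoutSquare.inl_desc _ _ _ _).symm (PushoutSquare.inr_desc _ _ _ _).symm
        (NaturalCone.po i.fst f.fst hi.fst).isPushout (NaturalCone.po i.snd f.snd hi.snd).isPushout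
        X.isCof hi.1 i.w hi.2 }
  inl := ⟨(NaturalCone.po i.fst f.fst hi.fst).inl, (NaturalCone.po i.snd f.snd hi.snd).inl,
    (PushoutSquare.inl_desc _ _ _ _).symm⟩
  inr := ⟨(NaturalCone.po i.fst f.fst hi.fst).inr, (NaturalCone.po i.snd f.snd hi.snd).inr,
    (PushoutSquare.inr_desc _ _ _ _).symm⟩
  w := hom_ext (PushoutSquare.w _) (PushoutSquare.w _)
  desc a b h := ⟨(NaturalCone.po i.fst f.fst hi.fst).desc a.fst b.fst (congrArg Hom.fst h),
    (NaturalCone.po i.snd f.snd hi.snd).desc a.snd b.snd (congrArg Hom.snd h), by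
      apply PushoutSquare.hom_ext
      · rw [PushoutSquare.inl_desc_assoc, PushoutSquare.inl_desc_assoc, Category.assoc,
          PushoutSquare.inl_desc, a.w]
      · rw [PushoutSquare.inr_desc_assoc, PushoutSquare.inr_desc_assoc, Category.assoc,
          PushoutSquare.inr_desc, b.w]⟩
  inl_desc _ _ _ := hom_ext (PushoutSquare.inl_desc _ _ _ _) (PushoutSquare.inl_desc _ _ _ _)
  inr_desc _ _ _ := hom_ext (PushoutSquare.inr_desc _ _ _ _) (PushoutSquare.inr_desc _ _ _ _)
  hom_ext _ _ h₁ h₂ := hom_ext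
    (PushoutSquare.hom_ext _ _ _ (congrArg Hom.fst h₁) (congrArg Hom.fst h₂))
    (PushoutSquare.hom_ext _ _ _ (congrArg Hom.snd h₁) (congrArg Hom.snd h₂))

theorem isPushout_components {A B X P : CofPair C} {i : B ⟶ A} {f : B ⟶ X} {f' : A ⟶ P}
    {i' : X ⟶ P} (hi : cof i) (h : IsPushout i f f' i') :
    IsPushout i.fst f.fst f'.fst i'.fst ∧ IsPushout i.snd f.snd f'.snd i'.snd := by
  let e := (po i f hi).isPushout.isoIsPushout _ _ h
  have e₁ : (po i f hi).inl ≫ e.hom = f' := IsPushout.inl_isoIsPushout_hom _ _ _ _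
  have e₂ : (po i f hi).inr ≫ e.hom = i' := IsPushout.inr_isoIsPushout_hom _ _ _ _
  let eF : (po i f hi).pt.fst ≅ P.fst := ⟨e.hom.fst, e.inv.fst,
    congrArg Hom.fst e.hom_inv_id, congrArg Hom.fst e.inv_hom_id⟩
  let eS : (po i f hi).pt.snd ≅ P.snd := ⟨e.hom.snd, e.inv.snd,
    congrArg Hom.snd e.hom_inv_id, congrArg Hom.snd e.inv_hom_id⟩
  constructor
  · exact (NaturalCone.po i.fst f.fst hi.fst).isPushout.of_iso (Iso.refl _) (Iso.refl _)
      (Iso.refl _) eF (by simp) (by simp) ((congrArg Hom.fst e₁).trans (Category.id_comp _).symm)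
      ((congrArg Hom.fst e₂).trans (Category.id_comp _).symm)
  · exact (NaturalCone.po i.snd f.snd hi.snd).isPushout.of_iso (Iso.refl _) (Iso.refl _)
      (Iso.refl _) eS (by simp) (by simp) ((congrArg Hom.snd e₁).trans (Category.id_comp _).symm)
      ((congrArg Hom.snd e₂).trans (Category.id_comp _).symm)

theorem cof_unit (P : CofPair C) : cof (monad.η.app P) :=
  (cof_iff _ (Cofib.next_isPushout ⟨_, P.map, P.isCof⟩) (Cofib.inl_next ⟨_, P.map, P.isCof⟩)
    (Cofib.inr_next ⟨_, P.map, P.isCof⟩)).2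
    ⟨NaturalCone.cof_unit _, (Cofib.next ⟨_, P.map, P.isCof⟩).isCof⟩

theorem cof_id (P : CofPair C) : cof (𝟙 P) :=
  (cof_iff (𝟙 P) (N := P.fst) (l := P.map) (r := 𝟙 _) (n := 𝟙 _) IsPushout.of_id_fst (by simp)
    (by simp)).2 ⟨NaturalCone.cof_id _, NaturalCone.cof_id _⟩

theorem cof_comp {P Q R : CofPair C} (a : P ⟶ Q) (b : Q ⟶ R) (ha : cof a) (hb : cof b) :
    cof (a ≫ b) := by
  obtain ⟨ha2, ha⟩ := ha
  obtain ⟨hb2, hb⟩ := hb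
  let Na := NaturalCone.po a.snd P.map ha2
  let Nb := NaturalCone.po b.snd Q.map hb2
  let D := NaturalCone.po b.snd Na.inl hb2
  have sq : IsPushout (a ≫ b).snd P.map D.inl (Na.inr ≫ D.inr) :=
    (Na.isPushout.flip.paste_vert D.isPushout.flip).flip
  let na : Na.pt ⟶ Q.fst := Na.desc Q.map a.fst a.w.symm
  have hna : Na.inl ≫ na = Q.map := Na.inl_desc _ _ _
  let nb : Nb.pt ⟶ R.fst := Nb.desc R.map b.fst b.w.symm
  let d : D.pt ⟶ Nb.pt := D.desc Nb.inl (na ≫ Nb.inr) (by rw [Nb.w, reassoc_of% hna])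
  have hd : IsPushout na D.inr Nb.inr d := by
    refine IsPushout.of_left (h₁₁ := Na.inl) (v₁₁ := b.snd) (h₂₁ := D.inl) ?_ ?_ D.isPushout.flip
    · rw [hna, D.inl_desc]; exact Nb.isPushout.flip
    · exact (D.inr_desc _ _ _).symm
  refine (cof_iff _ sq (n := d ≫ nb) ?_ ?_).2 ⟨NaturalCone.cof_comp _ _ ha2 hb2,
    NaturalCone.cof_comp _ _ (NaturalCone.cof_of_isPushout ha hd) hb⟩
  · simp only [d, nb, PushoutSquare.inl_desc_assoc, PushoutSquare.inl_desc]
  · simp only [d, nb, na, Category.assoc, PushoutSquare.inr_desc_assoc, PushoutSquare.inr_desc,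
      comp_fst]

theorem cof_of_isIso {P Q : CofPair C} (e : P ≅ Q) : cof e.hom := by
  have h1 : IsIso e.hom.fst := ⟨e.inv.fst, congrArg Hom.fst e.hom_inv_id,
    congrArg Hom.fst e.inv_hom_id⟩
  have h2 : IsIso e.hom.snd := ⟨e.inv.snd, congrArg Hom.snd e.hom_inv_id,
    congrArg Hom.snd e.inv_hom_id⟩
  refine (cof_iff e.hom (N := P.fst) (l := inv e.hom.snd ≫ P.map) (r := 𝟙 _) (n := e.hom.fst)
    (IsPushout.of_horiz_isIso ⟨by simp⟩) ?_ (by simp)).2 ⟨isCof_of_isIso _, isCof_of_isIso _⟩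
  rw [Category.assoc, e.hom.w, IsIso.inv_hom_id_assoc]

theorem nep_aux {A₁ A₂ B₁ B₂ N : C} {a : A₂ ⟶ A₁} {b : B₂ ⟶ B₁} {u : B₁ ⟶ A₁} {v : B₂ ⟶ A₂}
    (hv : IsCof v) {nl : A₂ ⟶ N} {nr : B₁ ⟶ N} (hN : IsPushout v b nl nr) {n : N ⟶ A₁}
    (hn : IsCof n) (hnl : nl ≫ n = a) (hnr : nr ≫ n = u) :
    ∃ (r : cone A₁ ⟶ cone B₁) (s : cone A₂ ⟶ cone B₂), coneMap a ≫ r = s ≫ coneMap b ∧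
      coneMap u ≫ r = 𝟙 _ ∧ coneMap v ≫ s = 𝟙 _ := by
  obtain ⟨s, hs⟩ : ∃ s : cone A₂ ⟶ cone B₂, coneMap v ≫ s = 𝟙 _ := NaturalCone.nep _ hv
  obtain ⟨r, hr⟩ : ∃ r : cone A₁ ⟶ cone N, coneMap n ≫ r = 𝟙 _ := NaturalCone.nep _ hn
  have sq : IsPushout (coneMap v) (coneMap b) (coneMap nl) (coneMap nr) :=
    NaturalCone.cone_isPushout hv hN
  have hw : coneMap v ≫ s ≫ coneMap b = coneMap b ≫ 𝟙 _ := by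
    rw [reassoc_of% hs, Category.comp_id]
  refine ⟨r ≫ sq.desc _ _ hw, s, ?_, ?_, hs⟩
  · rw [← hnl, coneMap_comp, Category.assoc, reassoc_of% hr, sq.inl_desc]
  · rw [← hnr, coneMap_comp, Category.assoc, reassoc_of% hr, sq.inr_desc]

theorem nep {A B : CofPair C} (i : B ⟶ A) (hi : cof i) :
    ∃ r : monad.obj A ⟶ monad.obj B, monad.map i ≫ r = 𝟙 _ := by
  obtain ⟨r, s, h₁, h₂, h₃⟩ := nep_aux hi.1 (NaturalCone.po i.snd B.map hi.1).isPushout hi.2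
    (PushoutSquare.inl_desc _ _ _ i.w.symm) (PushoutSquare.inr_desc _ _ _ i.w.symm)
  exact ⟨⟨r, s, h₁⟩, hom_ext h₂ h₃⟩

theorem relCone_corner {A₁ A₂ B₁ B₂ S₁ S₂ N : C} {a : A₂ ⟶ A₁} {b : B₂ ⟶ B₁} {p : S₂ ⟶ S₁}
    {u : B₁ ⟶ A₁} {v : B₂ ⟶ A₂} {l₁ : cone B₁ ⟶ S₁} {l₂ : cone B₂ ⟶ S₂} {r₁ : A₁ ⟶ S₁}
    {r₂ : A₂ ⟶ S₂} {s₁ : S₁ ⟶ cone A₁} {s₂ : S₂ ⟶ cone A₂}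
    (lw : coneMap b ≫ l₁ = l₂ ≫ p) (hrw : a ≫ r₁ = r₂ ≫ p)
    (sq₁ : IsPushout (κ B₁) u l₁ r₁) (sq₂ : IsPushout (κ B₂) v l₂ r₂)
    (hl₁ : l₁ ≫ s₁ = coneMap u) (hl₂ : l₂ ≫ s₂ = coneMap v)
    (hr₁ : r₁ ≫ s₁ = κ A₁) (hr₂ : r₂ ≫ s₂ = κ A₂)
    (hv : IsCof v) {nl : A₂ ⟶ N} {nr : B₁ ⟶ N} (hN : IsPushout v b nl nr) (n : N ⟶ A₁)
    (hn : IsCof n) (hnl : nl ≫ n = a) (hnr : nr ≫ n = u) :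
    ∃ (Q : C) (α : cone A₂ ⟶ Q) (β : S₁ ⟶ Q) (q : Q ⟶ cone A₁), IsPushout s₂ p α β ∧
      α ≫ q = coneMap a ∧ β ≫ q = s₁ ∧ IsCof q := by
  let m : Cofib A₁ := ⟨N, n, hn⟩
  have cN : IsPushout (coneMap v) (coneMap b) (coneMap nl) (coneMap nr) :=
    NaturalCone.cone_isPushout hv hN
  have sqm : IsPushout (κ N) n m.nextInl m.nextInr := m.next_isPushout
  have hw : κ B₁ ≫ coneMap nr ≫ m.nextInl = u ≫ m.nextInr := by
    rw [κ_nat_assoc, sqm.w, reassoc_of% hnr]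
  obtain ⟨t, tl, tr⟩ : ∃ t : S₁ ⟶ m.next.src, l₁ ≫ t = coneMap nr ≫ m.nextInl ∧
      r₁ ≫ t = m.nextInr := ⟨sq₁.desc _ _ hw, sq₁.inl_desc _ _ _, sq₁.inr_desc _ _ _⟩
  have comm : s₂ ≫ coneMap nl ≫ m.nextInl = p ≫ t := by
    apply sq₂.hom_ext
    · rw [reassoc_of% hl₂, ← reassoc_of% lw, tl, coneMap_sq_assoc hN.w]
    · rw [reassoc_of% hr₂, κ_nat_assoc, sqm.w, reassoc_of% hnl, ← reassoc_of% hrw, tr]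
  refine ⟨m.next.src, coneMap nl ≫ m.nextInl, t, m.next.hom, ?_, ?_, ?_, m.next.isCof⟩
  · refine ⟨⟨comm⟩, ⟨PushoutCocone.IsColimit.mk comm
      (fun c => sqm.desc (cN.desc c.inl (l₁ ≫ c.inr) ?_) (r₁ ≫ c.inr) ?_) ?_ ?_ ?_⟩⟩
    · rw [← hl₂, Category.assoc, c.condition, reassoc_of% lw]
    · apply hN.hom_ext
      · rw [← κ_nat_assoc, cN.inl_desc, reassoc_of% hnl, ← hr₂, Category.assoc, c.condition,
          reassoc_of% hrw]
      · rw [← κ_nat_assoc, cN.inr_desc, reassoc_of% hnr, reassoc_of% sq₁.w]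
    · intro c
      rw [Category.assoc, IsPushout.inl_desc, cN.inl_desc]
    · intro c
      apply sq₁.hom_ext
      · rw [reassoc_of% tl, IsPushout.inl_desc, cN.inr_desc]
      · rw [reassoc_of% tr, IsPushout.inr_desc]
    · intro c e h₁ h₂
      apply sqm.hom_ext
      · rw [IsPushout.inl_desc]
        apply cN.hom_ext
        · rw [cN.inl_desc, ← h₁, Category.assoc]
        · rw [cN.inr_desc, ← h₂, reassoc_of% tl]
      · rw [IsPushout.inr_desc, ← h₂, reassoc_of% tr]
  · rw [Category.assoc, m.inl_next, ← coneMap_comp, hnl]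
  · apply sq₁.hom_ext
    · rw [reassoc_of% tl, m.inl_next, ← coneMap_comp, hnr, hl₁]
    · rw [reassoc_of% tr, m.inr_next, hr₁]

theorem cof_relCone {A B S : CofPair C} {i : B ⟶ A} {l : monad.obj B ⟶ S} {r : A ⟶ S}
    (s : S ⟶ monad.obj A) (hi : cof i) (h : IsPushout (monad.η.app B) i l r)
    (hl : l ≫ s = monad.map i) (hr : r ≫ s = monad.η.app A) : cof s := by
  obtain ⟨sq₁, sq₂⟩ := isPushout_components (cof_unit B) h
  have hl₂ : l.snd ≫ s.snd = coneMap i.snd := congrArg Hom.snd hl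
  have hr₂ : r.snd ≫ s.snd = κ A.snd := congrArg Hom.snd hr
  have hs₂ : IsCof s.snd := NaturalCone.cof_relCone _ hi.snd sq₂ hl₂ hr₂
  obtain ⟨Q, α, β, q, h₁, h₂, h₃, h₄⟩ := relCone_corner (p := S.map) (s₁ := s.fst) l.w r.w sq₁ sq₂
    (congrArg Hom.fst hl) hl₂ (congrArg Hom.fst hr) hr₂ hi.1
    (NaturalCone.po i.snd B.map hi.1).isPushout _ hi.2
    (PushoutSquare.inl_desc _ _ _ i.w.symm) (PushoutSquare.inr_desc _ _ _ i.w.symm)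
  exact (cof_iff s h₁ h₂ h₃).2 ⟨hs₂, h₄⟩

/-- The category of pairs is a category with a natural cone. -/
instance : NaturalCone (CofPair C) where
  monad := monad
  cof := cof
  po i f hi := po i f hi
  cof_of_isPushout {_ _ _ _ i f _ _} hi h :=
    po_aux i f hi (isPushout_components hi h).1 (isPushout_components hi h).2
  cone_isPushout hi h := isPushout_of
    (NaturalCone.cone_isPushout hi.fst (isPushout_components hi h).1)
    (NaturalCone.cone_isPushout hi.snd (isPushout_components hi h).2)
  cof_id := cof_id
  cof_unit := cof_unit
  cof_comp := cof_comp
  nep := nep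
  cof_relCone := cof_relCone

end CofPair

end Pairs

section PairGroups

variable {C : Type u} [Category.{v} C] [NaturalCone C]

/-- The first component of a cofibration of pairs. -/
def Cofib.fst {Q : CofPair C} (i : Cofib Q) : Cofib Q.fst := ⟨i.src.fst, i.hom.fst, CofPair.cof.fst i.isCof⟩

/-- The second component of a cofibration of pairs. -/
def Cofib.snd {Q : CofPair C} (i : Cofib Q) : Cofib Q.snd := ⟨i.src.snd, i.hom.snd, CofPair.cof.snd i.isCof⟩

/-- The first component of a based cofibration of pairs. -/
def Based.fst {P : CofPair C} (b : Based P) : Based P.fst := ⟨b.A.fst, b.i.fst, b.h.fst⟩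

/-- The second component of a based cofibration of pairs. -/
def Based.snd {P : CofPair C} (b : Based P) : Based P.snd := ⟨b.A.snd, b.i.snd, b.h.snd⟩

/-- The first component `F` of a homotopy of pairs `(F, G)`. -/
def Htpy.fst {Q P : CofPair C} {i : Cofib (cone Q)} {f₀ f₁ : cone Q ⟶ P} (F : Htpy i f₀ f₁) :
    Htpy (A := Q.fst) (X := P.fst) i.fst f₀.fst f₁.fst :=
  ⟨F.hom.fst, congrArg CofPair.Hom.fst F.left, congrArg CofPair.Hom.fst F.right⟩

/-- The second component `G` of a homotopy of pairs `(F, G)`. -/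
def Htpy.snd {Q P : CofPair C} {i : Cofib (cone Q)} {f₀ f₁ : cone Q ⟶ P} (F : Htpy i f₀ f₁) :
    Htpy (A := Q.snd) (X := P.snd) i.snd f₀.snd f₁.snd :=
  ⟨F.hom.snd, congrArg CofPair.Hom.snd F.left, congrArg CofPair.Hom.snd F.right⟩

/-- `[(F, G)] ↦ [F]`. -/
def HBracket.fst {P : CofPair C} (b : Based P) :
    HBracket b.i b.h b.h →* HBracket b.fst.i b.fst.h b.fst.h :=
  HBracket.homOf Htpy.fst (fun _ _ ⟨H⟩ => ⟨Htpy.fst H⟩) rfl (fun F G =>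
    Htpy.homotopic_diff (i := b.fst.i) (m := (Htpy.mu b.i).fst) (F := F.fst) (G := G.fst)
      ⟨congrArg CofPair.Hom.fst (Htpy.mu_isMu b.i).left,
        congrArg CofPair.Hom.fst (Htpy.mu_isMu b.i).right⟩
      (p := (Htpy.pair b.i F.hom G.hom (F.left.trans G.left.symm)).fst)
      (congrArg CofPair.Hom.fst (Htpy.inl_pair F.hom G.hom (F.left.trans G.left.symm)))
      (congrArg CofPair.Hom.fst (Htpy.inr_pair F.hom G.hom (F.left.trans G.left.symm))) rfl)

/-- `[(F, G)] ↦ [G]`. -/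
def HBracket.snd {P : CofPair C} (b : Based P) :
    HBracket b.i b.h b.h →* HBracket b.snd.i b.snd.h b.snd.h :=
  HBracket.homOf Htpy.snd (fun _ _ ⟨H⟩ => ⟨Htpy.snd H⟩) rfl (fun F G =>
    Htpy.homotopic_diff (i := b.snd.i) (m := (Htpy.mu b.i).snd) (F := F.snd) (G := G.snd)
      ⟨congrArg CofPair.Hom.snd (Htpy.mu_isMu b.i).left,
        congrArg CofPair.Hom.snd (Htpy.mu_isMu b.i).right⟩
      (p := (Htpy.pair b.i F.hom G.hom (F.left.trans G.left.symm)).snd)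
      (congrArg CofPair.Hom.snd (Htpy.inl_pair F.hom G.hom (F.left.trans G.left.symm)))
      (congrArg CofPair.Hom.snd (Htpy.inr_pair F.hom G.hom (F.left.trans G.left.symm))) rfl)

/-- `[(F, G)] ↦ [G]` on homotopy groups of pairs. -/
def HGroup.snd {P : CofPair C} : (n : ℕ) → (b : Based P) → (HGroup b n →* HGroup b.snd n)
  | 0, b => HBracket.snd b
  | n + 1, b => HGroup.snd n b.shift

theorem lift_aux {Q₁ Q₂ B₁ B₂ X Y : C} {q : Q₂ ⟶ Q₁} {p : B₂ ⟶ B₁} {u : B₁ ⟶ cone Q₁}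
    {v : B₂ ⟶ cone Q₂} (hv : IsIso v) (w : p ≫ u = v ≫ coneMap q) {f : Y ⟶ X} {h₁ : cone Q₁ ⟶ X}
    {h₂ : cone Q₂ ⟶ Y} (hw : coneMap q ≫ h₁ = h₂ ≫ f) {F : cone (cone Q₁) ⟶ X}
    (hF : coneMap u ≫ F = coneMap u ≫ ρ Q₁ ≫ h₁) :
    coneMap (coneMap q) ≫ F = (ρ Q₂ ≫ h₂) ≫ f := by
  have e : coneMap (coneMap q) = coneMap (inv v ≫ p) ≫ coneMap u := by
    rw [← coneMap_comp, Category.assoc, w, IsIso.inv_hom_id_assoc]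
  rw [e, Category.assoc, hF, ← Category.assoc (coneMap (inv v ≫ p)), ← e, ← ρ_nat_assoc, hw,
    Category.assoc]

/-- If `v` is an isomorphism, a homotopy `F` relative to `u` gives the homotopy of pairs
`(F, g ρ)` relative to `(u, v)`. -/
def Htpy.lift {Q P : CofPair C} {i : Cofib (cone Q)} (hi : IsIso i.hom.snd) {f₀ f₁ : cone Q ⟶ P}
    (h : f₀.snd = f₁.snd) (F : Htpy (A := Q.fst) (X := P.fst) i.fst f₀.fst f₁.fst) :
    Htpy i f₀ f₁ where
  hom := ⟨F.hom, ρ Q.snd ≫ f₀.snd, lift_aux hi i.hom.w f₀.w F.left⟩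
  left := CofPair.hom_ext F.left rfl
  right := CofPair.hom_ext F.right ((κ_ρ_assoc Q.snd (f₀.snd : cone Q.snd ⟶ P.snd)).trans h)

theorem Cofib.next_isIso {A : C} (i : Cofib A) [IsIso i.hom] : IsIso i.next.hom := by
  have : IsIso i.nextInl :=
    (MorphismProperty.isomorphisms C).of_isPushout i.next_isPushout
      (MorphismProperty.isomorphisms.infer_property i.hom)
  have : IsIso (i.nextInl ≫ i.next.hom) := by rw [i.inl_next]; infer_instance
  exact IsIso.of_isIso_comp_left i.nextInl _

theorem Htpy.lift_fst {Q P : CofPair C} {i : Cofib (cone Q)} (hi : IsIso i.hom.snd)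
    {f₀ f₁ : cone Q ⟶ P} (h : f₀.snd = f₁.snd) (F : Htpy i f₀ f₁) : Htpy.lift hi h F.fst = F := by
  refine Htpy.ext (CofPair.hom_ext rfl ?_)
  have : IsIso (coneMap i.hom.snd) := inferInstance
  have e : coneMap i.hom.snd ≫ (F.hom.snd : cone (cone Q.snd) ⟶ P.snd) =
      coneMap i.hom.snd ≫ ρ Q.snd ≫ f₀.snd := congrArg CofPair.Hom.snd F.left
  exact ((cancel_epi (coneMap i.hom.snd)).1 e).symm

/-- If `v` is an isomorphism: `[F] ↦ [(F, g ρ)]`. -/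
def HBracket.lift {P : CofPair C} (b : Based P) (hi : IsIso b.i.hom.snd) :
    HBracket b.fst.i b.fst.h b.fst.h → HBracket b.i b.h b.h :=
  Quotient.map (Htpy.lift hi rfl) (fun _ _ ⟨H⟩ => ⟨Htpy.lift (i := b.i.next)
    (@Cofib.next_isIso _ _ _ _ b.i.snd hi) rfl H⟩)

theorem HBracket.lift_fst {P : CofPair C} (b : Based P) (hi : IsIso b.i.hom.snd)
    (a : HBracket b.i b.h b.h) : HBracket.lift b hi (HBracket.fst b a) = a := by
  induction a using Quotient.inductionOn with | _ F
  exact congrArg HBracket.mk (Htpy.lift_fst hi rfl F)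

theorem HBracket.fst_lift {P : CofPair C} (b : Based P) (hi : IsIso b.i.hom.snd)
    (a : HBracket b.fst.i b.fst.h b.fst.h) : HBracket.fst b (HBracket.lift b hi a) = a := by
  induction a using Quotient.inductionOn with | _ F
  rfl

/-- If `v` is an isomorphism, `[F] ↦ [(F, g ρ)]` is an isomorphism. -/
noncomputable def HBracket.theta {P : CofPair C} (b : Based P) (hi : IsIso b.i.hom.snd) :
    HBracket b.fst.i b.fst.h b.fst.h ≃* HBracket b.i b.h b.h where
  toFun := HBracket.lift b hi
  invFun := HBracket.fst b
  left_inv := HBracket.fst_lift b hi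
  right_inv := HBracket.lift_fst b hi
  map_mul' x y := by
    rw [← HBracket.lift_fst b hi (_ * _), map_mul, HBracket.fst_lift, HBracket.fst_lift]

/-- If `v` is an isomorphism, `[F] ↦ [(F, g ρ^{n+1})]` is an isomorphism
`π_{n+1}^u(X, f') ⟶ π_{n+1}^{(u, v)}((X, Y), (f', g))`. -/
noncomputable def HGroup.theta {P : CofPair C} : (n : ℕ) → (b : Based P) → IsIso b.i.hom.snd →
    (HGroup b.fst n ≃* HGroup b n)
  | 0, b, hi => HBracket.theta b hi
  | n + 1, b, hi => HGroup.theta n b.shift (@Cofib.next_isIso _ _ _ _ b.i.snd hi)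

/-- The pair `(C A, A)`, given by the cofibration `κ : A ⟶ C A`. -/
def conePair (A : C) : CofPair C := ⟨cone A, A, κ A, NaturalCone.cof_unit A⟩

/-- The cofibration of pairs `(C i, i) : (C B, B) ⟶ (C A, A)`. -/
def Cofib.conePair {A : C} (i : Cofib A) : Cofib (conePair A) where
  src := GenHtpy.conePair i.src
  hom := ⟨coneMap i.hom, i.hom, κ_nat i.hom⟩
  isCof := (CofPair.cof_iff _ i.next_isPushout.flip i.inr_next i.inl_next).2 ⟨i.isCof, i.next.isCof⟩

/-- The cofibration of pairs `(i₁, 1) : (Σ^i, A) ⟶ (C A, A)`, where `(Σ^i, A)` is given by the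
induced cofibration `A ⟶ Σ^i`. -/
def Cofib.sigmaPair {A : C} (i : Cofib A) : Cofib (GenHtpy.conePair A) where
  src := ⟨i.next.src, A, i.nextInr,
    NaturalCone.cof_of_isPushout (NaturalCone.cof_unit _) i.next_isPushout⟩
  hom := ⟨i.next.hom, 𝟙 A, i.inr_next.trans (Category.id_comp _).symm⟩
  isCof := (CofPair.cof_iff _ IsPushout.of_id_fst i.inr_next (Category.id_comp _)).2
    ⟨NaturalCone.cof_id A, i.next.isCof⟩

/-- The commutative square `(1, 1) (C i, i) = (i₁, 1) (ī, i)`. -/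
theorem Cofib.conePair_sq {A : C} (i : Cofib A) :
    ∃ k, i.conePair.hom ≫ 𝟙 (GenHtpy.conePair A) = k ≫ i.sigmaPair.hom :=
  ⟨(⟨i.nextInl, i.hom, i.next_isPushout.w⟩ : i.conePair.src ⟶ i.sigmaPair.src),
    CofPair.hom_ext ((Category.comp_id _).trans i.inl_next.symm) rfl⟩

/-- The base morphism `(f h ρ, h) : C(C A, A) ⟶ (X, Y)` of a pair `f : Y ⟶ X` and `h : C A ⟶ Y`. -/
def pairBase (P : CofPair C) {A : C} (h : cone A ⟶ P.snd) : cone (conePair A) ⟶ P :=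
  ⟨ρ A ≫ h ≫ P.map, h, coneκ_ρ_assoc A (h ≫ P.map)⟩

/-- The homotopy group of a pair,
`π_{n+3}^i((X, Y), h) = π_{n+2}^{(C i, i)}((X, Y), (f h ρ, h))`. -/
abbrev PairGroup (P : CofPair C) {A : C} (i : Cofib A) (h : cone A ⟶ P.snd) (n : ℕ) : Type v :=
  RelGroup i.conePair (pairBase P h) n

/-- `f_* : π_{n+2}^i(Y, h) ⟶ π_{n+2}^i(X, f h)`, `[F] ↦ [f F]`. -/
def fStar (P : CofPair C) {A : C} (i : Cofib A) (h : cone A ⟶ P.snd) (n : ℕ) :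
    RelGroup i h n →* RelGroup i (h ≫ P.map) n := HGroup.push P.map n i.next h (h ≫ P.map) rfl

/-- `θ_{n+1} : π_{n+3}^i(X, f h) ⟶ π_{n+2}^{(i₁, 1)}((X, Y), (f h ρ, h))`, `[F] ↦ [(F, h ρ^{n+1})]`. -/
noncomputable def theta (P : CofPair C) {A : C} (i : Cofib A) (h : cone A ⟶ P.snd) (n : ℕ) :
    RelGroup i (h ≫ P.map) (n + 1) ≃* RelGroup i.sigmaPair (pairBase P h) n :=
  HGroup.theta n ⟨conePair A, i.sigmaPair.next, pairBase P h⟩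
    (@Cofib.next_isIso _ _ _ _ i.sigmaPair.snd (inferInstanceAs (IsIso (𝟙 A))))

/-- `(1, 1)^* : π_{n+2}^{(i₁, 1)}((X, Y), (f h ρ, h)) ⟶ π_{n+2}^{(C i, i)}((X, Y), (f h ρ, h))`, for
the commutative square `(1, 1) (C i, i) = (i₁, 1) (ī, i)`. -/
def oneStar (P : CofPair C) {A : C} (i : Cofib A) (h : cone A ⟶ P.snd) (n : ℕ) :
    RelGroup i.sigmaPair (pairBase P h) n →* PairGroup P i h n :=
  HGroup.pull n (𝟙 (conePair A)) i.conePair.next i.sigmaPair.next (Cofib.next_sq i.conePair_sq)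
    (pairBase P h) (pairBase P h) (by rw [coneMap_id, Category.id_comp])

/-- `j_{n+1} = (1, 1)^* θ_{n+1} : π_{n+3}^i(X, f h) ⟶ π_{n+3}^i((X, Y), h)`. -/
noncomputable def jHom (P : CofPair C) {A : C} (i : Cofib A) (h : cone A ⟶ P.snd) (n : ℕ) :
    RelGroup i (h ≫ P.map) (n + 1) →* PairGroup P i h n :=
  (oneStar P i h n).comp (theta P i h n).toMonoidHom

/-- `δ_{n+1} : π_{n+3}^i((X, Y), h) ⟶ π_{n+2}^i(Y, h)`, `[(F, G)] ↦ [G]`. -/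
def deltaHom (P : CofPair C) {A : C} (i : Cofib A) (h : cone A ⟶ P.snd) (n : ℕ) :
    PairGroup P i h n →* RelGroup i h n := HGroup.snd n ⟨conePair A, i.conePair.next, pairBase P h⟩

end PairGroups
end GenHtpy

/-!
For fixed `A` and `X`, the morphisms `Cⁿ⁺¹ A ⟶ X` are the `n`-simplices of an augmented simplicial set:
the `k`-th face is precomposition with `C^k κ`, the `k`-th degeneracy is precomposition with `C^k ρ`.
The source of `iₙ` is glued from `Cⁿ B` and the faces `Cⁿ⁻¹ A` (`exists_glue`). Hence an element of
`π_{n+2}^i(X, h)` is represented by a spherical simplex, all of whose faces are degenerate at `h`, and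
a homotopy is a simplex whose faces other than `0` and `1` are degenerate at `h`. Since the cone of a
cofibration has a retraction, every horn with missing face `0` has a filler (`exists_horn_filler`).

A homotopy of pairs relative to `(C i, i)` is a simplex `F` in `X` together with a spherical simplex `G`
in `Y` such that the *last* face of `F` is `f G`. The exact sequence therefore comes down to comparing the
last face with face `0`. Let `LastRel K F` mean that some simplex has last face `K`, face `0` equal to
`F`, and all other faces degenerate at `h`. Horn fillers give three facts.

* For every `K` there is an `F` with `LastRel K F` (`IsSpherical.exists_lastRel`).
* The relation is symmetric (`LastRel.symm`).
* `LastRel K F` and `LastRel K F'` imply that `F'` and `F` are homotopic (`LastRel.sphHomotopic`).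

Write `1` for the constant simplex. Exactness at `π(Y, h)`: `f G` is null-homotopic iff `LastRel 1 (f G)`, and `[G]` is in the image of `δ` iff
`LastRel (f G) 1`. Exactness at `π(X, f h)`: a null homotopy of `j [F]` consists of a spherical simplex `K`
in `Y` and a simplex that shows `LastRel (f K) F`; by the first and third facts `F` is homotopic to some
`f K'`, and by the first two every `f K'` occurs in this way. Exactness at `π((X, Y), h)`: a homotopy of
the last face to the constant extends to the whole simplex (`exists_extension_of_last`).

The groups of index `n` are the brackets at the `n`-th iterated relative cones, so it suffices to treat
brackets of an arbitrary level `r`, with cofibrations `iᵣ₊₁` on `Cʳ⁺¹ A`.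
-/

namespace GenHtpy

variable {C : Type u} [Category.{v} C] [NaturalCone C]

/-! ### Iterated cones, their faces and degeneracies -/

/-- The iterated cone `Cⁿ A`, with `Cⁿ⁺¹ A = C(Cⁿ A)`. -/
abbrev iterCone : ℕ → C → C
  | 0, A => A
  | n + 1, A => cone (iterCone n A)

/-- The morphism `Cⁿ g`. -/
def iterMap : (n : ℕ) → {A A' : C} → (A ⟶ A') → (iterCone n A ⟶ iterCone n A')
  | 0, _, _, g => g
  | n + 1, _, _, g => coneMap (iterMap n g)

/-- The coface `C^k κ : Cⁿ A ⟶ Cⁿ⁺¹ A`, meaningful for `k ≤ n`. Precomposition with it is the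
`k`-th face of a morphism `Cⁿ⁺¹ A ⟶ X`, regarded as an `n`-simplex. -/
def face (A : C) : (n : ℕ) → ℕ → (iterCone n A ⟶ iterCone (n + 1) A)
  | _, 0 => κ _
  | 0, _ + 1 => κ _
  | n + 1, k + 1 => coneMap (face A n k)

/-- The codegeneracy `C^k ρ : Cⁿ⁺² A ⟶ Cⁿ⁺¹ A`, meaningful for `k ≤ n`. -/
def degen (A : C) : (n : ℕ) → ℕ → (iterCone (n + 2) A ⟶ iterCone (n + 1) A)
  | _, 0 => ρ _
  | 0, _ + 1 => ρ _
  | n + 1, k + 1 => coneMap (degen A n k)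

theorem face_zero (A : C) (n : ℕ) : face A n 0 = κ (iterCone n A) := by
  cases n <;> rfl

theorem face_succ (A : C) (n k : ℕ) : face A (n + 1) (k + 1) = coneMap (face A n k) := rfl

theorem degen_zero (A : C) (n : ℕ) : degen A n 0 = ρ (iterCone n A) := by
  cases n <;> rfl

theorem degen_succ (A : C) (n k : ℕ) : degen A (n + 1) (k + 1) = coneMap (degen A n k) := rfl

theorem iterMap_comp (n : ℕ) {A A' A'' : C} (g : A ⟶ A') (g' : A' ⟶ A'') :
    iterMap n (g ≫ g') = iterMap n g ≫ iterMap n g' := by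
  induction n with
  | zero => rfl
  | succ n ih => exact (congrArg coneMap ih).trans (coneMap_comp _ _)

theorem face_face (A : C) (n : ℕ) {j k : ℕ} (hjk : j ≤ k) (hk : k ≤ n) :
    face A n k ≫ face A (n + 1) j = face A n j ≫ face A (n + 1) (k + 1) := by
  induction n generalizing j k with
  | zero =>
    obtain rfl : k = 0 := by omega
    obtain rfl : j = 0 := by omega
    exact (κ_nat _).symm
  | succ n ih =>
    rcases j with _ | j
    · rw [face_zero, face_zero]
      exact (κ_nat _).symm
    · rcases k with _ | k
      · omega
      · exact coneMap_sq (ih (by omega) (by omega))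

theorem face_degen_self (A : C) (n : ℕ) {k : ℕ} (hk : k ≤ n) :
    face A (n + 1) k ≫ degen A n k = 𝟙 _ := by
  induction n generalizing k with
  | zero =>
    obtain rfl : k = 0 := by omega
    exact κ_ρ _
  | succ n ih =>
    rcases k with _ | k
    · exact κ_ρ _
    · rw [face_succ, degen_succ, ← coneMap_comp, ih (by omega)]
      exact coneMap_id _

theorem face_degen_succ (A : C) (n : ℕ) {k : ℕ} (hk : k ≤ n) :
    face A (n + 1) (k + 1) ≫ degen A n k = 𝟙 _ := by
  induction n generalizing k with
  | zero =>
    obtain rfl : k = 0 := by omega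
    exact coneκ_ρ _
  | succ n ih =>
    rcases k with _ | k
    · exact coneκ_ρ _
    · rw [face_succ, degen_succ, ← coneMap_comp, ih (by omega)]
      exact coneMap_id _

theorem face_degen_of_le (A : C) (n : ℕ) {j k : ℕ} (hjk : j ≤ k) (hk : k ≤ n) :
    face A (n + 2) j ≫ degen A (n + 1) (k + 1) = degen A n k ≫ face A (n + 1) j := by
  induction n generalizing j k with
  | zero =>
    obtain rfl : k = 0 := by omega
    obtain rfl : j = 0 := by omega
    exact κ_nat _
  | succ n ih =>
    rcases j with _ | j
    · exact κ_nat _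
    · rcases k with _ | k
      · omega
      · exact coneMap_sq (ih (by omega) (by omega))

theorem face_degen_of_lt (A : C) (n : ℕ) {j k : ℕ} (hjk : k < j) (hj : j ≤ n + 1) :
    face A (n + 2) (j + 1) ≫ degen A (n + 1) k = degen A n k ≫ face A (n + 1) j := by
  induction n generalizing j k with
  | zero =>
    obtain rfl : k = 0 := by omega
    obtain rfl : j = 1 := by omega
    exact (ρ_nat _).symm
  | succ n ih =>
    rcases j with _ | j
    · omega
    · rcases k with _ | k
      · exact (ρ_nat _).symm
      · exact coneMap_sq (ih (by omega) (by omega))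

theorem face_nat {A A' : C} (g : A ⟶ A') (n k : ℕ) :
    face A n k ≫ iterMap (n + 1) g = iterMap n g ≫ face A' n k := by
  induction n generalizing k with
  | zero => cases k <;> exact κ_nat _
  | succ n ih =>
    rcases k with _ | k
    · exact κ_nat _
    · exact coneMap_sq (ih k)

theorem degen_nat {A A' : C} (g : A ⟶ A') (n k : ℕ) :
    degen A n k ≫ iterMap (n + 1) g = iterMap (n + 2) g ≫ degen A' n k := by
  induction n generalizing k with
  | zero => cases k <;> exact ρ_nat _
  | succ n ih =>
    rcases k with _ | k
    · exact ρ_nat _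
    · exact coneMap_sq (ih k)

/-- The morphism `h ρⁿ : Cⁿ⁺¹ A ⟶ X`, the degenerate simplex at `h`. -/
def base {A X : C} (h : cone A ⟶ X) : (n : ℕ) → (iterCone (n + 1) A ⟶ X)
  | 0 => h
  | n + 1 => ρ (iterCone n A) ≫ base h n

theorem base_comp {A X Y : C} (h : cone A ⟶ X) (g : X ⟶ Y) (n : ℕ) :
    base (h ≫ g) n = base h n ≫ g := by
  induction n with
  | zero => rfl
  | succ n ih => rw [base, base, ih, Category.assoc]

theorem degen_base {A X : C} (h : cone A ⟶ X) (n : ℕ) {k : ℕ} (hk : k ≤ n) :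
    degen A n k ≫ base h n = base h (n + 1) := by
  induction n generalizing k with
  | zero =>
    obtain rfl : k = 0 := by omega
    rfl
  | succ n ih =>
    rcases k with _ | k
    · rfl
    · have h1 : degen A (n + 1) (k + 1) ≫ degen A n 0 = degen A (n + 1) 0 ≫ degen A n k := by
        rcases n with _ | n
        · obtain rfl : k = 0 := by omega
          exact (ρ_ρ _).symm
        · rcases k with _ | k
          · exact (ρ_ρ _).symm
          · exact (ρ_nat _).symm
      rw [← ih (k := 0) (by omega), ← Category.assoc, h1, Category.assoc, ih (by omega), degen_zero]
      rfl

theorem face_base {A X : C} (h : cone A ⟶ X) (n : ℕ) {k : ℕ} (hk : k ≤ n + 1) :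
    face A (n + 1) k ≫ base h (n + 1) = base h n := by
  rcases k with _ | k
  · rw [← degen_base h n (Nat.zero_le n), ← Category.assoc, face_degen_self _ _ (Nat.zero_le n),
      Category.id_comp]
  · rw [← degen_base h n (by omega : k ≤ n), ← Category.assoc, face_degen_succ _ _ (by omega),
      Category.id_comp]

/-! ### The boundary of an iterated cone -/

/-- The iterated relative cone `iₙ`. -/
abbrev bdry {A : C} (i : Cofib A) : (n : ℕ) → Cofib (iterCone n A)
  | 0 => i
  | n + 1 => (bdry i n).next

/-- The morphism `Cⁿ B ⟶ Σ` into the source of `iₙ`. -/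
def bdryBase {A : C} (i : Cofib A) : (n : ℕ) → (iterCone n i.src ⟶ (bdry i n).src)
  | 0 => 𝟙 _
  | n + 1 => coneMap (bdryBase i n) ≫ (bdry i n).nextInl

/-- The `k`-th face `Cⁿ A ⟶ Σ` into the source of `iₙ₊₁`. -/
def bdryFace {A : C} (i : Cofib A) : (n : ℕ) → ℕ → (iterCone n A ⟶ (bdry i (n + 1)).src)
  | n, 0 => (bdry i n).nextInr
  | 0, _ + 1 => (bdry i 0).nextInr
  | n + 1, k + 1 => coneMap (bdryFace i n k) ≫ (bdry i (n + 1)).nextInl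

theorem bdryBase_hom {A : C} (i : Cofib A) (n : ℕ) :
    bdryBase i n ≫ (bdry i n).hom = iterMap n i.hom := by
  induction n with
  | zero => exact Category.id_comp _
  | succ n ih =>
    rw [bdryBase, Category.assoc]
    refine (congrArg (_ ≫ ·) (Cofib.inl_next _)).trans ?_
    exact (coneMap_comp _ _).symm.trans (congrArg coneMap ih)

theorem bdryFace_hom {A : C} (i : Cofib A) (n k : ℕ) :
    bdryFace i n k ≫ (bdry i (n + 1)).hom = face A n k := by
  induction n generalizing k with
  | zero => cases k <;> exact Cofib.inr_next _
  | succ n ih =>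
    rcases k with _ | k
    · exact Cofib.inr_next _
    · rw [bdryFace, Category.assoc]
      refine (congrArg (_ ≫ ·) (Cofib.inl_next _)).trans ?_
      exact (coneMap_comp _ _).symm.trans (congrArg coneMap (ih k))

/-- The cone as a functor. -/
abbrev coneFunctor : C ⥤ C := (NaturalCone.monad (C := C)).toFunctor

/-- A functor carries pushouts of cofibrations to pushouts. -/
def PreservesCofPushouts (Φ : C ⥤ C) : Prop :=
  ∀ {A B X P : C} {i : B ⟶ A} {f : B ⟶ X} {f' : A ⟶ P} {i' : X ⟶ P},
    IsCof i → IsPushout i f f' i' → IsPushout (Φ.map i) (Φ.map f) (Φ.map f') (Φ.map i')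

theorem PreservesCofPushouts.id : PreservesCofPushouts (𝟭 C) := fun _ h => h

theorem PreservesCofPushouts.cone : PreservesCofPushouts (coneFunctor (C := C)) :=
  fun hi h => NaturalCone.cone_isPushout hi h

theorem PreservesCofPushouts.cone_comp {Φ : C ⥤ C} (hΦ : PreservesCofPushouts Φ) :
    PreservesCofPushouts (coneFunctor ⋙ Φ) :=
  fun {_ _ _ _ i _ _ _} hi h =>
    hΦ (Cofib.coneCofib ⟨_, i, hi⟩).isCof (NaturalCone.cone_isPushout hi h)

theorem map_next_isPushout {Φ : C ⥤ C} (hΦ : PreservesCofPushouts Φ) {A : C} (j : Cofib A) :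
    IsPushout (Φ.map (κ j.src)) (Φ.map j.hom) (Φ.map j.nextInl) (Φ.map j.nextInr) :=
  hΦ (NaturalCone.cof_unit _) j.next_isPushout

/-- The faces and `Cⁿ⁺¹ B` are jointly epimorphic in the boundary. -/
theorem bdry_hom_ext {A : C} (i : Cofib A) (n : ℕ) {Φ : C ⥤ C} (hΦ : PreservesCofPushouts Φ) {X : C}
    {s t : Φ.obj (bdry i (n + 1)).src ⟶ X}
    (hb : Φ.map (bdryBase i (n + 1)) ≫ s = Φ.map (bdryBase i (n + 1)) ≫ t)
    (hf : ∀ k ≤ n, Φ.map (bdryFace i n k) ≫ s = Φ.map (bdryFace i n k) ≫ t) : s = t := by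
  induction n generalizing Φ with
  | zero =>
    refine (map_next_isPushout hΦ (bdry i 0)).hom_ext ?_ (hf 0 le_rfl)
    have e : bdryBase i 1 = (bdry i 0).nextInl := by
      change coneMap (𝟙 _) ≫ _ = _
      rw [coneMap_id, Category.id_comp]
    rwa [e] at hb
  | succ n ih =>
    refine (map_next_isPushout hΦ (bdry i (n + 1))).hom_ext (ih hΦ.cone_comp ?_ fun k hk => ?_) ?_
    · rw [← Category.assoc, ← Category.assoc]
      have e : (coneFunctor ⋙ Φ).map (bdryBase i (n + 1)) ≫ Φ.map (bdry i (n + 1)).nextInl =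
        Φ.map (bdryBase i (n + 2)) := (Φ.map_comp _ _).symm
      rw [e]
      exact hb
    · rw [← Category.assoc, ← Category.assoc]
      have e : (coneFunctor ⋙ Φ).map (bdryFace i n k) ≫ Φ.map (bdry i (n + 1)).nextInl =
        Φ.map (bdryFace i (n + 1) (k + 1)) := (Φ.map_comp _ _).symm
      rw [e]
      exact hf (k + 1) (by omega)
    · exact hf 0 (by omega)

/-- A map on the cone of the boundary together with a map on the outermost face glue. -/
theorem exists_glue_step {A : C} (i : Cofib A) (n : ℕ) {Φ : C ⥤ C} (hΦ : PreservesCofPushouts Φ)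
    {X : C} (b : Φ.obj (iterCone (n + 2) i.src) ⟶ X) (a : ℕ → (Φ.obj (iterCone (n + 1) A) ⟶ X))
    (hab : Φ.map (face i.src (n + 1) 0) ≫ b = Φ.map (iterMap (n + 1) i.hom) ≫ a 0)
    (haa : ∀ k ≤ n, Φ.map (face A n 0) ≫ a (k + 1) = Φ.map (face A n k) ≫ a 0)
    (s : Φ.obj (cone (bdry i (n + 1)).src) ⟶ X)
    (hsb : Φ.map (coneMap (bdryBase i (n + 1))) ≫ s = b)
    (hsa : ∀ k ≤ n, Φ.map (coneMap (bdryFace i n k)) ≫ s = a (k + 1)) :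
    ∃ t : Φ.obj (bdry i (n + 2)).src ⟶ X, Φ.map (bdryBase i (n + 2)) ≫ t = b ∧
      ∀ k ≤ n + 1, Φ.map (bdryFace i (n + 1) k) ≫ t = a k := by
  have sq := map_next_isPushout hΦ (bdry i (n + 1))
  have w : Φ.map (κ (bdry i (n + 1)).src) ≫ s = Φ.map (bdry i (n + 1)).hom ≫ a 0 := by
    refine bdry_hom_ext i n hΦ ?_ fun k hk => ?_
    · rw [← Category.assoc, ← Category.assoc, ← Φ.map_comp, ← Φ.map_comp, bdryBase_hom,
        ← κ_nat, Φ.map_comp, Category.assoc, hsb, ← hab, face_zero]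
    · rw [← Category.assoc, ← Category.assoc, ← Φ.map_comp, ← Φ.map_comp, bdryFace_hom,
        ← κ_nat, Φ.map_comp, Category.assoc, hsa k hk, ← haa k hk, face_zero]
  refine ⟨sq.desc s (a 0) w, ?_, fun k hk => ?_⟩
  · have e : Φ.map (bdryBase i (n + 2)) = Φ.map (coneMap (bdryBase i (n + 1))) ≫
      Φ.map (bdry i (n + 1)).nextInl := Φ.map_comp _ _
    rw [e, Category.assoc, sq.inl_desc, hsb]
  · rcases k with _ | k
    · exact sq.inr_desc _ _ _
    · have e : Φ.map (bdryFace i (n + 1) (k + 1)) = Φ.map (coneMap (bdryFace i n k)) ≫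
        Φ.map (bdry i (n + 1)).nextInl := Φ.map_comp _ _
      rw [e, Category.assoc, sq.inl_desc, hsa k (by omega)]

/-- A map on the boundary is given by maps on its faces that agree on common faces. -/
theorem exists_glue {A : C} (i : Cofib A) (n : ℕ) {Φ : C ⥤ C} (hΦ : PreservesCofPushouts Φ)
    {X : C} (b : Φ.obj (iterCone (n + 2) i.src) ⟶ X) (a : ℕ → (Φ.obj (iterCone (n + 1) A) ⟶ X))
    (hab : ∀ k ≤ n + 1,
      Φ.map (face i.src (n + 1) k) ≫ b = Φ.map (iterMap (n + 1) i.hom) ≫ a k)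
    (haa : ∀ j k, j ≤ k → k ≤ n → Φ.map (face A n j) ≫ a (k + 1) = Φ.map (face A n k) ≫ a j) :
    ∃ t : Φ.obj (bdry i (n + 2)).src ⟶ X, Φ.map (bdryBase i (n + 2)) ≫ t = b ∧
      ∀ k ≤ n + 1, Φ.map (bdryFace i (n + 1) k) ≫ t = a k := by
  induction n generalizing Φ with
  | zero =>
    have sq := map_next_isPushout hΦ.cone_comp (bdry i 0)
    have w : (coneFunctor ⋙ Φ).map (κ (bdry i 0).src) ≫ b =
      (coneFunctor ⋙ Φ).map (bdry i 0).hom ≫ a 1 := hab 1 le_rfl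
    refine exists_glue_step i 0 hΦ b a (hab 0 (by omega)) (fun k hk => haa 0 k (by omega) hk)
      (sq.desc b (a 1) w) ?_ fun k hk => ?_
    · have e : bdryBase i 1 = (bdry i 0).nextInl := by
        change coneMap (𝟙 _) ≫ _ = _
        rw [coneMap_id, Category.id_comp]
      rw [e]
      exact sq.inl_desc _ _ _
    · obtain rfl : k = 0 := by omega
      exact sq.inr_desc _ _ _
  | succ n ih =>
    obtain ⟨s, hsb, hsa⟩ := ih hΦ.cone_comp b (fun k => a (k + 1))
      (fun k hk => hab (k + 1) (by omega)) (fun j k hjk hk => haa (j + 1) (k + 1) (by omega) (by omega))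
    exact exists_glue_step i (n + 1) hΦ b a (hab 0 (by omega))
      (fun k hk => haa 0 k (by omega) hk) s hsb hsa

/-- Two morphisms agree on the boundary iff they agree on all faces and on `Cⁿ⁺¹ B`, also after
applying a functor such as the cone. -/
theorem map_bdry_agree {A : C} (i : Cofib A) (n : ℕ) {Φ : C ⥤ C} (hΦ : PreservesCofPushouts Φ)
    {X : C} {F G : Φ.obj (iterCone (n + 1) A) ⟶ X} :
    Φ.map (bdry i (n + 1)).hom ≫ F = Φ.map (bdry i (n + 1)).hom ≫ G ↔
      Φ.map (iterMap (n + 1) i.hom) ≫ F = Φ.map (iterMap (n + 1) i.hom) ≫ G ∧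
        ∀ k ≤ n, Φ.map (face A n k) ≫ F = Φ.map (face A n k) ≫ G := by
  constructor
  · intro h
    refine ⟨?_, fun k _ => ?_⟩
    · rw [← bdryBase_hom, Φ.map_comp, Category.assoc, h, Category.assoc]
    · rw [← bdryFace_hom i, Φ.map_comp, Category.assoc, h, Category.assoc]
  · rintro ⟨h₁, h₂⟩
    refine bdry_hom_ext i n hΦ ?_ fun k hk => ?_
    · rw [← Category.assoc, ← Category.assoc, ← Φ.map_comp, bdryBase_hom, h₁]
    · rw [← Category.assoc, ← Category.assoc, ← Φ.map_comp, bdryFace_hom, h₂ k hk]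

/-- Horns with missing face `0` have fillers: morphisms `a 1, …, a (n + 2)` on `Cⁿ⁺² A` that agree
on common faces are the faces of a morphism on `Cⁿ⁺³ A` with prescribed restriction to `Cⁿ⁺³ B`.
The reason is that the cone of the cofibration `iₙ₊₂` has a retraction. -/
theorem exists_horn_filler {A : C} (i : Cofib A) (n : ℕ) {X : C} (b : iterCone (n + 3) i.src ⟶ X)
    (a : ℕ → (iterCone (n + 2) A ⟶ X))
    (hab : ∀ k, 1 ≤ k → k ≤ n + 2 →
      face i.src (n + 2) k ≫ b = iterMap (n + 2) i.hom ≫ a k)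
    (haa : ∀ j k, 1 ≤ j → j ≤ k → k ≤ n + 1 →
      face A (n + 1) j ≫ a (k + 1) = face A (n + 1) k ≫ a j) :
    ∃ W : iterCone (n + 3) A ⟶ X, iterMap (n + 3) i.hom ≫ W = b ∧
      ∀ k, 1 ≤ k → k ≤ n + 2 → face A (n + 2) k ≫ W = a k := by
  obtain ⟨s, hsb, hsa⟩ := exists_glue i n PreservesCofPushouts.cone b (fun k => a (k + 1))
    (fun k hk => hab (k + 1) (by omega) (by omega))
    (fun j k hjk hk => haa (j + 1) (k + 1) (by omega) (by omega) (by omega))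
  obtain ⟨r, hr⟩ := NaturalCone.nep _ (bdry i (n + 2)).isCof
  refine ⟨r ≫ s, ?_, fun k hk hk' => ?_⟩
  · have e : iterMap (n + 3) i.hom = coneMap (bdryBase i (n + 2)) ≫ coneMap (bdry i (n + 2)).hom := by
      rw [← coneMap_comp, bdryBase_hom]; rfl
    rw [e, Category.assoc]
    refine Eq.trans ?_ hsb
    exact congrArg (_ ≫ ·) ((Category.assoc _ _ _).symm.trans
      ((congrArg (· ≫ s) hr).trans (Category.id_comp s)))
  · obtain ⟨k, rfl⟩ : ∃ l, k = l + 1 := ⟨k - 1, by omega⟩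
    have e : face A (n + 2) (k + 1) =
        coneMap (bdryFace i (n + 1) k) ≫ coneMap (bdry i (n + 2)).hom := by
      rw [← coneMap_comp, bdryFace_hom]; rfl
    rw [e, Category.assoc]
    refine Eq.trans ?_ (hsa k (by omega))
    exact congrArg (_ ≫ ·) ((Category.assoc _ _ _).symm.trans
      ((congrArg (· ≫ s) hr).trans (Category.id_comp s)))

/-! ### Simplices with prescribed faces -/

/-- The simplex `H : Cⁿ⁺² A ⟶ X` has faces `φ 0, …, φ (n + 1)` and agrees with the degenerate simplex
at `h` on `Cⁿ⁺² B`. -/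
structure HasFaces {A X : C} (i : Cofib A) (h : cone A ⟶ X) (n : ℕ) (H : iterCone (n + 2) A ⟶ X)
    (φ : ℕ → (iterCone (n + 1) A ⟶ X)) : Prop where
  rel : iterMap (n + 2) i.hom ≫ H = iterMap (n + 2) i.hom ≫ base h (n + 1)
  eq : ∀ k ≤ n + 1, face A (n + 1) k ≫ H = φ k

/-- A spherical simplex: all its faces are degenerate at `h`. -/
abbrev IsSpherical {A X : C} (i : Cofib A) (h : cone A ⟶ X) (n : ℕ)
    (F : iterCone (n + 2) A ⟶ X) : Prop := HasFaces i h n F fun _ => base h n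

section Simplices

variable {A X : C} {i : Cofib A} {h : cone A ⟶ X} {n : ℕ}

theorem isSpherical_base (i : Cofib A) (h : cone A ⟶ X) (n : ℕ) :
    IsSpherical i h n (base h (n + 1)) := ⟨rfl, fun _ hk => face_base h n hk⟩

theorem HasFaces.comp {Y : C} {H : iterCone (n + 2) A ⟶ X} {φ : ℕ → (iterCone (n + 1) A ⟶ X)}
    (hH : HasFaces i h n H φ) (f : X ⟶ Y) :
    HasFaces i (h ≫ f) n (H ≫ f) fun k => φ k ≫ f where
  rel := by rw [← Category.assoc, hH.rel, Category.assoc, base_comp]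
  eq k hk := by rw [← Category.assoc, hH.eq k hk]

theorem HasFaces.congr {H : iterCone (n + 2) A ⟶ X} {φ ψ : ℕ → (iterCone (n + 1) A ⟶ X)}
    (hH : HasFaces i h n H φ) (e : ∀ k ≤ n + 1, φ k = ψ k) : HasFaces i h n H ψ :=
  ⟨hH.rel, fun k hk => (hH.eq k hk).trans (e k hk)⟩

theorem IsSpherical.comp {Y : C} {F : iterCone (n + 2) A ⟶ X} (hF : IsSpherical i h n F)
    (f : X ⟶ Y) : IsSpherical i (h ≫ f) n (F ≫ f) :=
  (HasFaces.comp hF f).congr fun _ _ => (base_comp h f n).symm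

theorem iterMap_degen_base {F : iterCone (n + 2) A ⟶ X}
    (hF : iterMap (n + 2) i.hom ≫ F = iterMap (n + 2) i.hom ≫ base h (n + 1)) {k : ℕ}
    (hk : k ≤ n + 1) :
    iterMap (n + 3) i.hom ≫ degen A (n + 1) k ≫ F = iterMap (n + 3) i.hom ≫ base h (n + 2) := by
  rw [← degen_base h (n + 1) hk, ← Category.assoc, ← Category.assoc, ← degen_nat, Category.assoc, hF,
    Category.assoc]

/-- The faces of a degeneracy of a spherical simplex. -/
theorem IsSpherical.degen {F : iterCone (n + 2) A ⟶ X} (hF : IsSpherical i h n F) {k : ℕ}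
    (hk : k ≤ n + 1) : HasFaces i h (n + 1) (GenHtpy.degen A (n + 1) k ≫ F)
      fun j => if j = k ∨ j = k + 1 then F else base h (n + 1) where
  rel := iterMap_degen_base hF.rel hk
  eq j hj := by
    rcases lt_trichotomy j k with hjk | rfl | hjk
    · obtain ⟨k, rfl⟩ : ∃ l, k = l + 1 := ⟨k - 1, by omega⟩
      rw [if_neg (by omega), ← Category.assoc, face_degen_of_le A n (by omega) (by omega),
        Category.assoc, hF.eq j (by omega), degen_base h n (by omega)]
    · rw [if_pos (Or.inl rfl), ← Category.assoc, face_degen_self A _ hk, Category.id_comp]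
    · obtain ⟨j, rfl⟩ : ∃ l, j = l + 1 := ⟨j - 1, by omega⟩
      rcases (by omega : k = j ∨ k < j) with rfl | hjk
      · rw [if_pos (Or.inr rfl), ← Category.assoc, face_degen_succ A _ hk, Category.id_comp]
      · rw [if_neg (by omega), ← Category.assoc, face_degen_of_lt A n hjk (by omega),
          Category.assoc, hF.eq j (by omega), degen_base h n (by omega)]

/-- A filler of a horn with missing face `0`, and the faces of the face that it adds. -/
theorem exists_filler (i : Cofib A) (h : cone A ⟶ X) (n : ℕ) (a : ℕ → (iterCone (n + 2) A ⟶ X))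
    (hab : ∀ k, 1 ≤ k → k ≤ n + 2 →
      iterMap (n + 2) i.hom ≫ a k = iterMap (n + 2) i.hom ≫ base h (n + 1))
    (haa : ∀ j k, 1 ≤ j → j ≤ k → k ≤ n + 1 →
      face A (n + 1) j ≫ a (k + 1) = face A (n + 1) k ≫ a j) :
    ∃ (W : iterCone (n + 3) A ⟶ X) (H : iterCone (n + 2) A ⟶ X),
      HasFaces i h (n + 1) W (fun k => if k = 0 then H else a k) ∧
        HasFaces i h n H (fun k => face A (n + 1) 0 ≫ a (k + 1)) := by
  obtain ⟨W, hW, hWa⟩ := exists_horn_filler i n (iterMap (n + 3) i.hom ≫ base h (n + 2)) a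
    (fun k hk hk' => by
      rw [hab k hk hk', ← Category.assoc, face_nat, Category.assoc, face_base h _ hk']) haa
  refine ⟨W, face A (n + 2) 0 ≫ W, ⟨hW, fun k hk => ?_⟩, ⟨?_, fun k hk => ?_⟩⟩
  · split_ifs with h0
    · rw [h0]
    · exact hWa k (by omega) hk
  · rw [← Category.assoc, ← face_nat, Category.assoc, hW, ← Category.assoc, face_nat,
      Category.assoc, face_base h _ (by omega)]
  · rw [← hWa (k + 1) (by omega) (by omega), ← Category.assoc, ← Category.assoc,
      face_face A (n + 1) (Nat.zero_le k) hk]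

/-- Spherical simplices `F` and `G` are homotopic: some simplex has `G` and `F` as faces `0` and `1`,
and its other faces are degenerate at `h`. -/
def SphHomotopic (i : Cofib A) (h : cone A ⟶ X) (n : ℕ) (F G : iterCone (n + 2) A ⟶ X) : Prop :=
  ∃ H : iterCone (n + 3) A ⟶ X, HasFaces i h (n + 1) H fun k =>
    if k = 0 then G else if k = 1 then F else base h (n + 1)

/-- Some simplex has `K` and `F` as its last face and face `0`, and its other faces are degenerate
at `h`. For homotopy classes of spherical simplices this says that `[F] = [K]` up to a sign that
depends on the dimension. -/
def LastRel (i : Cofib A) (h : cone A ⟶ X) (n : ℕ) (K F : iterCone (n + 2) A ⟶ X) : Prop :=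
  ∃ H : iterCone (n + 3) A ⟶ X, HasFaces i h (n + 1) H fun k =>
    if k = 0 then F else if k = n + 2 then K else base h (n + 1)

theorem lastRel_base (i : Cofib A) (h : cone A ⟶ X) (n : ℕ) :
    LastRel i h n (base h (n + 1)) (base h (n + 1)) :=
  ⟨_, (isSpherical_base i h (n + 1)).congr fun k _ => by simp⟩

theorem LastRel.comp {Y : C} {K F : iterCone (n + 2) A ⟶ X} (hKF : LastRel i h n K F) (f : X ⟶ Y) :
    LastRel i (h ≫ f) n (K ≫ f) (F ≫ f) := by
  obtain ⟨H, hH⟩ := hKF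
  refine ⟨H ≫ f, (hH.comp f).congr fun k _ => ?_⟩
  rw [base_comp]
  split_ifs <;> rfl

/-- Every spherical simplex is a last face. -/
theorem IsSpherical.exists_lastRel {K : iterCone (n + 2) A ⟶ X} (hK : IsSpherical i h n K) :
    ∃ F, IsSpherical i h n F ∧ LastRel i h n K F := by
  have ha : ∀ k : ℕ, IsSpherical i h n (if k = n + 2 then K else base h (n + 1)) := fun k => by
    split_ifs
    · exact hK
    · exact isSpherical_base i h n
  obtain ⟨W, F, hW, hF⟩ := exists_filler i h n (fun k => if k = n + 2 then K else base h (n + 1))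
    (fun k _ _ => (ha k).rel)
    (fun j k _ hjk hk => ((ha _).eq j (by omega)).trans ((ha _).eq k hk).symm)
  exact ⟨F, hF.congr fun k _ => (ha (k + 1)).eq 0 (by omega), W, hW⟩

/-- The relation `LastRel` is symmetric. The degeneracies `s₀ F, s₁ F, …` link the outermost
coordinate of the iterated cone with the innermost one. -/
theorem LastRel.symm {F K : iterCone (n + 2) A ⟶ X} (hF : IsSpherical i h n F)
    (hFK : LastRel i h n F K) : LastRel i h n K F := by
  obtain ⟨J, hJ⟩ := hFK
  -- Face `k ≤ n + 2` of the horn is `s_{k-1} F`, which has `F` as faces `k - 1` and `k`, so neighbouring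
  -- faces match; the chain ends with `J`, whose last face is `F` and whose face `0` is `K`.
  obtain ⟨W, H, -, hH⟩ := exists_filler i h (n + 1)
    (fun k => if k = n + 3 then J else degen A (n + 1) (k - 1) ≫ F)
    (fun k hk hk' => by
      split_ifs
      · exact hJ.rel
      · exact (hF.degen (by omega)).rel)
    (fun j k hj hjk hk => by
      rw [if_neg (by omega : ¬ j = n + 3), (hF.degen (by omega)).eq k (by omega)]
      split_ifs with h₁ h₂ h₂
      · rw [hJ.eq j (by omega), if_neg (by omega), if_pos (by omega)]
      · rw [hJ.eq j (by omega), if_neg (by omega), if_neg (by omega)]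
      · rw [(hF.degen (by omega)).eq j (by omega), if_pos (by omega)]
      · rw [(hF.degen (by omega)).eq j (by omega), if_neg (by omega)])
  refine ⟨H, hH.congr fun k hk => ?_⟩
  by_cases h₁ : k = n + 2
  · rw [if_pos (by omega), hJ.eq 0 (by omega), if_pos rfl, if_neg (by omega), if_pos h₁]
  · rw [if_neg (by omega), (hF.degen (by omega)).eq 0 (by omega), if_neg h₁]
    exact if_congr (by omega) rfl rfl

/-- Up to homotopy, the last face determines face `0`. -/
theorem LastRel.sphHomotopic {K F F' : iterCone (n + 2) A ⟶ X} (hK : IsSpherical i h n K)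
    (hF : LastRel i h n K F) (hF' : LastRel i h n K F') : SphHomotopic i h n F' F := by
  obtain ⟨H, hH⟩ := hF
  obtain ⟨J, hJ⟩ := hF'
  have hb := isSpherical_base i h (n + 1)
  have hd := hK.degen (k := 1) (by omega)
  -- The faces `1` and `2` of the horn are `H` and `J`. Their last faces `K` are the faces `1` and `2` of
  -- `s₁ K`, which is the last face of the horn.
  obtain ⟨W, L, -, hL⟩ := exists_filler i h (n + 1)
    (fun k => if k = 1 then H else if k = 2 then J else if k = n + 3 then degen A (n + 1) 1 ≫ K
      else base h (n + 2))
    (fun k hk hk' => by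
      split_ifs
      · exact hH.rel
      · exact hJ.rel
      · exact hd.rel
      · exact hb.rel)
    (fun j k hj hjk hk => by
      rw [if_neg (by omega : ¬ k + 1 = 1), if_neg (by omega : ¬ j = n + 3)]
      have hl : face A (n + 2) j ≫ (if k + 1 = 2 then J else if k + 1 = n + 3 then
          degen A (n + 1) 1 ≫ K else base h (n + 2)) =
          if k = n + 2 ∧ j ≤ 2 then K else base h (n + 1) := by
        split_ifs
        · omega
        · rw [hJ.eq j (by omega), if_neg (by omega), if_neg (by omega)]
        · rw [hd.eq j (by omega), if_pos (by omega)]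
        · rw [hd.eq j (by omega), if_neg (by omega)]
        · omega
        · exact hb.eq j (by omega)
      rw [hl]
      split_ifs
      · rw [hH.eq k (by omega), if_neg (by omega), if_pos (by omega)]
      · rw [hJ.eq k (by omega), if_neg (by omega), if_pos (by omega)]
      · omega
      · rw [hH.eq k (by omega), if_neg (by omega), if_neg (by omega)]
      · rw [hJ.eq k (by omega), if_neg (by omega), if_neg (by omega)]
      · exact (hb.eq k (by omega)).symm)
  refine ⟨L, hL.congr fun k hk => ?_⟩
  split_ifs <;> first
    | omega
    | rw [hH.eq 0 (by omega), if_pos rfl]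
    | rw [hJ.eq 0 (by omega), if_pos rfl]
    | rw [hd.eq 0 (by omega), if_neg (by omega)]
    | exact hb.eq 0 (by omega)

/-- If the last face of a simplex is homotopic to the degenerate simplex, then the homotopy extends
to the simplex. -/
theorem exists_extension_of_last {F K : iterCone (n + 3) A ⟶ X} {G : iterCone (n + 2) A ⟶ X}
    (hF : HasFaces i h (n + 1) F fun k => if k = n + 2 then G else base h (n + 1))
    (hK : HasFaces i h (n + 1) K fun k => if k = 1 then G else base h (n + 1)) :
    ∃ (W : iterCone (n + 4) A ⟶ X) (H : iterCone (n + 3) A ⟶ X), IsSpherical i h (n + 1) H ∧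
      HasFaces i h (n + 2) W fun k =>
        if k = 0 then H else if k = 1 then F else if k = n + 3 then K else base h (n + 2) := by
  have hb := isSpherical_base i h (n + 1)
  obtain ⟨W, H, hW, hH⟩ := exists_filler i h (n + 1)
    (fun k => if k = 1 then F else if k = n + 3 then K else base h (n + 2))
    (fun k hk hk' => by
      split_ifs
      · exact hF.rel
      · exact hK.rel
      · exact hb.rel)
    (fun j k hj hjk hk => by
      rw [if_neg (by omega : ¬ k + 1 = 1), if_neg (by omega : ¬ j = n + 3)]
      split_ifs with h₁ h₂ h₂
      · rw [hK.eq j (by omega), hF.eq k (by omega), if_pos h₂, if_pos (by omega)]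
      · rw [hK.eq j (by omega), hb.eq k (by omega), if_neg h₂]
      · rw [hb.eq j (by omega), hF.eq k (by omega), if_neg (by omega)]
      · rw [hb.eq j (by omega), hb.eq k (by omega)])
  refine ⟨W, H, hH.congr fun k hk => ?_, hW⟩
  split_ifs with h₁ h₂
  · rw [hF.eq 0 (by omega), if_neg (by omega)]
  · rw [hK.eq 0 (by omega), if_neg (by omega)]
  · exact hb.eq 0 (by omega)

end Simplices

/-! ### Iterated cones of a cone -/

/-- The isomorphism `Cⁿ(C A) ≅ Cⁿ⁺¹ A`. -/
def shiftIso (A : C) : (n : ℕ) → (iterCone n (cone A) ≅ iterCone (n + 1) A)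
  | 0 => Iso.refl _
  | n + 1 => coneFunctor.mapIso (shiftIso A n)

theorem face_shiftIso (A : C) (n : ℕ) {k : ℕ} (hk : k ≤ n) :
    face (cone A) n k ≫ (shiftIso A (n + 1)).hom = (shiftIso A n).hom ≫ face A (n + 1) k := by
  induction n generalizing k with
  | zero =>
    obtain rfl : k = 0 := by omega
    exact κ_nat _
  | succ n ih =>
    rcases k with _ | k
    · exact κ_nat _
    · exact coneMap_sq (ih (by omega))

theorem iterMap_κ_shiftIso (A : C) (n : ℕ) : iterMap n (κ A) ≫ (shiftIso A n).hom = face A n n := by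
  induction n with
  | zero => exact Category.comp_id _
  | succ n ih => exact (coneMap_comp _ _).symm.trans (congrArg coneMap ih)

theorem iterMap_coneMap_shiftIso {A A' : C} (g : A ⟶ A') (n : ℕ) :
    iterMap n (coneMap g) ≫ (shiftIso A' n).hom = (shiftIso A n).hom ≫ iterMap (n + 1) g := by
  induction n with
  | zero => exact (Category.comp_id _).trans (Category.id_comp _).symm
  | succ n ih => exact coneMap_sq ih

theorem shiftIso_base {A X : C} (h : cone A ⟶ X) (n : ℕ) :
    (shiftIso A (n + 1)).hom ≫ base h (n + 1) = base (ρ A ≫ h) n := by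
  induction n with
  | zero =>
    have e : (shiftIso A 1).hom = 𝟙 _ := coneMap_id _
    rw [e, Category.id_comp]
    rfl
  | succ n ih => exact (ρ_nat_assoc _ _).symm.trans (congrArg (ρ _ ≫ ·) ih)

theorem iterMap_isCof {A B : C} {i : B ⟶ A} (hi : IsCof i) (n : ℕ) : IsCof (iterMap n i) := by
  induction n with
  | zero => exact hi
  | succ n ih => exact (Cofib.coneCofib ⟨_, _, ih⟩).isCof

theorem iterMap_isPushout {A B X P : C} {i : B ⟶ A} {f : B ⟶ X} {f' : A ⟶ P} {i' : X ⟶ P}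
    (hi : IsCof i) (h : IsPushout i f f' i') (n : ℕ) :
    IsPushout (iterMap n i) (iterMap n f) (iterMap n f') (iterMap n i') := by
  induction n with
  | zero => exact h
  | succ n ih => exact NaturalCone.cone_isPushout (iterMap_isCof hi n) ih

theorem iterMap_next_agree {A X : C} (i : Cofib A) (n : ℕ) {F G : iterCone n (cone A) ⟶ X} :
    iterMap n i.next.hom ≫ F = iterMap n i.next.hom ≫ G ↔
      iterMap n (coneMap i.hom) ≫ F = iterMap n (coneMap i.hom) ≫ G ∧
        iterMap n (κ A) ≫ F = iterMap n (κ A) ≫ G := by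
  rw [← i.inl_next, ← i.inr_next, iterMap_comp, iterMap_comp]
  simp only [Category.assoc]
  exact ⟨fun h => ⟨congrArg _ h, congrArg _ h⟩, fun h =>
    (iterMap_isPushout (NaturalCone.cof_unit _) i.next_isPushout n).hom_ext h.1 h.2⟩

/-- A simplex on `Cⁿ⁺³ A` is a simplex on `Cⁿ⁺²(C A)` together with its last face. -/
theorem hasFaces_iff_coneCofib {A X : C} {i : Cofib A} {h : cone A ⟶ X} {n : ℕ}
    {H : iterCone (n + 3) A ⟶ X} {φ : ℕ → (iterCone (n + 2) A ⟶ X)} :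
    HasFaces i h (n + 1) H φ ↔
      HasFaces i.coneCofib (ρ A ≫ h) n ((shiftIso A (n + 2)).hom ≫ H)
        (fun k => (shiftIso A (n + 1)).hom ≫ φ k) ∧
      iterMap (n + 2) (κ A) ≫ (shiftIso A (n + 2)).hom ≫ H = φ (n + 2) := by
  have hrel : iterMap (n + 2) i.coneCofib.hom ≫ (shiftIso A (n + 2)).hom ≫ H =
      iterMap (n + 2) i.coneCofib.hom ≫ base (ρ A ≫ h) (n + 1) ↔
      iterMap (n + 3) i.hom ≫ H = iterMap (n + 3) i.hom ≫ base h (n + 2) := by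
    change iterMap (n + 2) (coneMap i.hom) ≫ _ = iterMap (n + 2) (coneMap i.hom) ≫ _ ↔ _
    rw [← shiftIso_base, ← Category.assoc, ← Category.assoc, iterMap_coneMap_shiftIso,
      Category.assoc, Category.assoc, cancel_epi]
  have e₂ : iterMap (n + 2) (κ A) ≫ (shiftIso A (n + 2)).hom ≫ H = face A (n + 2) (n + 2) ≫ H := by
    rw [← Category.assoc, iterMap_κ_shiftIso]
  have e₃ : ∀ k ≤ n + 1, face (cone A) (n + 1) k ≫ (shiftIso A (n + 2)).hom ≫ H =
      (shiftIso A (n + 1)).hom ≫ face A (n + 2) k ≫ H := fun k hk => by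
    rw [← Category.assoc, face_shiftIso A (n + 1) hk, Category.assoc]
  constructor
  · intro hH
    exact ⟨⟨hrel.2 hH.rel, fun k hk => by rw [e₃ k hk, hH.eq k (by omega)]⟩,
      by rw [e₂, hH.eq (n + 2) le_rfl]⟩
  · rintro ⟨hH, hl⟩
    refine ⟨hrel.1 hH.rel, fun k hk => ?_⟩
    rcases (by omega : k = n + 2 ∨ k ≤ n + 1) with rfl | hk
    · rw [← e₂, hl]
    · have := hH.eq k hk
      rwa [e₃ k hk, cancel_epi] at this

theorem iterMap_κ_base {A X : C} (h : cone A ⟶ X) (n : ℕ) :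
    iterMap (n + 1) (κ A) ≫ base (ρ A ≫ h) n = base h n := by
  rw [← shiftIso_base, ← Category.assoc, iterMap_κ_shiftIso, face_base h n le_rfl]

theorem hasFaces_next_iff {A X : C} {i : Cofib A} {h : cone A ⟶ X} {n : ℕ}
    {F : iterCone (n + 2) (cone A) ⟶ X} {φ : ℕ → (iterCone (n + 1) (cone A) ⟶ X)} :
    HasFaces i.next (ρ A ≫ h) n F φ ↔ HasFaces i.coneCofib (ρ A ≫ h) n F φ ∧
      iterMap (n + 2) (κ A) ≫ F = base h (n + 1) := by
  rw [← iterMap_κ_base h (n + 1)]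
  constructor
  · intro hF
    have := (iterMap_next_agree i (n + 2)).1 hF.rel
    exact ⟨⟨this.1, hF.eq⟩, this.2⟩
  · rintro ⟨hF, hl⟩
    exact ⟨(iterMap_next_agree i (n + 2)).2 ⟨hF.rel, hl⟩, hF.eq⟩

/-- Simplices on `Cⁿ⁺²(C A)` relative to `i₁` are the simplices on `Cⁿ⁺³ A` relative to `i` whose last
face is degenerate. -/
theorem hasFaces_next_iff' {A X : C} {i : Cofib A} {h : cone A ⟶ X} {n : ℕ}
    {H : iterCone (n + 3) A ⟶ X} {φ : ℕ → (iterCone (n + 2) A ⟶ X)} (hφ : φ (n + 2) = base h (n + 1)) :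
    HasFaces i.next (ρ A ≫ h) n ((shiftIso A (n + 2)).hom ≫ H)
      (fun k => (shiftIso A (n + 1)).hom ≫ φ k) ↔ HasFaces i h (n + 1) H φ := by
  rw [hasFaces_next_iff, hasFaces_iff_coneCofib, hφ]

theorem isSpherical_next_iff {A X : C} {i : Cofib A} {h : cone A ⟶ X} {n : ℕ}
    {H : iterCone (n + 3) A ⟶ X} :
    IsSpherical i.next (ρ A ≫ h) n ((shiftIso A (n + 2)).hom ≫ H) ↔ IsSpherical i h (n + 1) H := by
  have e := hasFaces_next_iff' (i := i) (h := h) (H := H) (φ := fun _ => base h (n + 1)) rfl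
  rwa [shiftIso_base] at e

/-! ### Homotopies as simplices -/

/-- A homotopy relative to `iₙ₊₁` from the constant to itself is a spherical simplex. -/
theorem spherical_iff {A X : C} {i : Cofib A} {h : cone A ⟶ X} {n : ℕ}
    {j : Cofib (iterCone (n + 1) A)} (hj : j = bdry i (n + 1)) {F : iterCone (n + 2) A ⟶ X} :
    (coneMap j.hom ≫ F = coneMap j.hom ≫ ρ (iterCone n A) ≫ base h n ∧
      κ (iterCone (n + 1) A) ≫ F = base h n) ↔ IsSpherical i h n F := by
  subst hj
  have hn : (bdry i (n + 2)).hom ≫ F = (bdry i (n + 2)).hom ≫ base h (n + 1) ↔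
      IsSpherical i h n F := by
    refine (map_bdry_agree i (n + 1) PreservesCofPushouts.id).trans
      ⟨fun h' => ⟨h'.1, fun k hk => (h'.2 k hk).trans (face_base h n hk)⟩,
        fun h' => ⟨h'.rel, fun k hk => (h'.eq k hk).trans (face_base h n hk).symm⟩⟩
  rw [← hn]
  have e : κ (iterCone (n + 1) A) ≫ base h (n + 1) = base h n := face_base h n (Nat.zero_le _)
  constructor
  · rintro ⟨h₁, h₂⟩
    exact (bdry i (n + 1)).next_ext h₁ (h₂.trans e.symm)
  · intro h'
    refine ⟨?_, ?_⟩
    · refine ((bdry i (n + 1)).inl_next_assoc F).symm.trans ?_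
      refine Eq.trans ?_ ((bdry i (n + 1)).inl_next_assoc _)
      exact congrArg _ h'
    · rw [← e]
      refine ((bdry i (n + 1)).inr_next_assoc F).symm.trans ?_
      refine Eq.trans ?_ ((bdry i (n + 1)).inr_next_assoc _)
      exact congrArg _ h'

/-- A homotopy between spherical simplices is a simplex with these as faces `1` and `0`. -/
theorem homotopy_iff {A X : C} {i : Cofib A} {h : cone A ⟶ X} {n : ℕ}
    {j : Cofib (iterCone (n + 1) A)} (hj : j = bdry i (n + 1)) {F G : iterCone (n + 2) A ⟶ X}
    (hF : IsSpherical i h n F) {H : iterCone (n + 3) A ⟶ X} :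
    (coneMap j.next.hom ≫ H = coneMap j.next.hom ≫ ρ (iterCone (n + 1) A) ≫ F ∧
      κ (iterCone (n + 2) A) ≫ H = G) ↔
      HasFaces i h (n + 1) H fun k => if k = 0 then G else if k = 1 then F else base h (n + 1) := by
  subst hj
  have hd := hF.degen (k := 0) (by omega)
  have hm : coneMap (bdry i (n + 2)).hom ≫ H = coneMap (bdry i (n + 2)).hom ≫
      ρ (iterCone (n + 1) A) ≫ F ↔ _ :=
    map_bdry_agree i (n + 1) PreservesCofPushouts.cone
  constructor
  · rintro ⟨h₁, h₂⟩
    obtain ⟨h₃, h₄⟩ := hm.1 h₁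
    refine ⟨h₃.trans hd.rel, fun k hk => ?_⟩
    rcases k with _ | k
    · exact h₂
    · rw [if_neg (by omega)]
      refine ((h₄ k (by omega)).trans (hd.eq (k + 1) hk)).trans (if_congr (by omega) rfl rfl)
  · intro hH
    refine ⟨hm.2 ⟨hH.rel.trans hd.rel.symm, fun k hk => ?_⟩, hH.eq 0 (by omega)⟩
    refine ((hH.eq (k + 1) (by omega)).trans ?_).trans (hd.eq (k + 1) (by omega)).symm
    rw [if_neg (by omega)]
    exact if_congr (by omega) rfl rfl

section Homotopies

variable {A X : C} {i : Cofib A} {h : cone A ⟶ X} {n : ℕ} {j : Cofib (iterCone (n + 1) A)}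

theorem Htpy.isSpherical (hj : j = bdry i (n + 1))
    (F : Htpy (A := iterCone n A) j (base h n) (base h n)) : IsSpherical i h n F.hom :=
  (spherical_iff hj).1 ⟨F.left, F.right⟩

/-- A spherical simplex as a homotopy. -/
def Htpy.ofSpherical (hj : j = bdry i (n + 1)) {F : iterCone (n + 2) A ⟶ X}
    (hF : IsSpherical i h n F) : Htpy (A := iterCone n A) j (base h n) (base h n) :=
  ⟨F, ((spherical_iff hj).2 hF).1, ((spherical_iff hj).2 hF).2⟩

theorem Htpy.homotopic_iff (hj : j = bdry i (n + 1))
    {F G : Htpy (A := iterCone n A) j (base h n) (base h n)} :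
    F ≈ G ↔ SphHomotopic i h n F.hom G.hom :=
  ⟨fun ⟨H⟩ => ⟨H.hom, (homotopy_iff hj (F.isSpherical hj)).1 ⟨H.left, H.right⟩⟩,
    fun ⟨H, hH⟩ => ⟨⟨H, ((homotopy_iff hj (F.isSpherical hj)).2 hH).1,
      ((homotopy_iff hj (F.isSpherical hj)).2 hH).2⟩⟩⟩

end Homotopies

/-! ### Homotopies of pairs as simplices -/

/-- The iterated cone `Cⁿ(C A, A)` of the pair `(C A, A)`. -/
abbrev pairIter (A : C) (n : ℕ) : CofPair C :=
  ⟨iterCone n (cone A), iterCone n A, iterMap n (κ A), iterMap_isCof (NaturalCone.cof_unit A) n⟩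

/-- The base morphism `(f h ρⁿ⁺¹, h ρⁿ)` of pairs. -/
def pairBaseIter (P : CofPair C) {A : C} (h : cone A ⟶ P.snd) (n : ℕ) :
    cone (pairIter A n) ⟶ P :=
  ⟨base (ρ A ≫ h ≫ P.map) n, base h n, (iterMap_κ_base (h ≫ P.map) n).trans (base_comp h P.map n)⟩

section Level

variable {P : CofPair C} {A : C} {i : Cofib A} {h : cone A ⟶ P.snd} {r : ℕ}
  {τ : Cofib (cone (pairIter A r))}

/-- A simplex `F` on `Cʳ⁺³ A` whose last face is `f G`, with the spherical simplex `G`, is a homotopy of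
pairs. -/
def Htpy.ofLast (hτ₁ : τ.fst = bdry i.coneCofib (r + 1)) (hτ₂ : τ.snd = bdry i (r + 1))
    {F : iterCone (r + 3) A ⟶ P.fst} {G : iterCone (r + 2) A ⟶ P.snd} (hG : IsSpherical i h r G)
    (hF : HasFaces i (h ≫ P.map) (r + 1) F
      fun k => if k = r + 2 then G ≫ P.map else base (h ≫ P.map) (r + 1)) :
    Htpy (A := pairIter A r) τ (pairBaseIter P h r) (pairBaseIter P h r) :=
  have hF' := hasFaces_iff_coneCofib.1 hF
  have hF₁ : IsSpherical i.coneCofib (ρ A ≫ h ≫ P.map) r ((shiftIso A (r + 2)).hom ≫ F) :=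
    hF'.1.congr fun k hk => by
      rw [if_neg (by omega), shiftIso_base]
  { hom := ⟨(shiftIso A (r + 2)).hom ≫ F, G, hF'.2.trans (if_pos rfl)⟩
    left := CofPair.hom_ext ((spherical_iff hτ₁).2 hF₁).1 ((spherical_iff hτ₂).2 hG).1
    right := CofPair.hom_ext ((spherical_iff hτ₁).2 hF₁).2 ((spherical_iff hτ₂).2 hG).2 }

theorem Htpy.fst_hasFaces (hτ₁ : τ.fst = bdry i.coneCofib (r + 1))
    (S : Htpy (A := pairIter A r) τ (pairBaseIter P h r) (pairBaseIter P h r))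
    {F : iterCone (r + 3) A ⟶ P.fst} (hF : S.hom.fst = (shiftIso A (r + 2)).hom ≫ F) :
    HasFaces i (h ≫ P.map) (r + 1) F
      fun k => if k = r + 2 then S.hom.snd ≫ P.map else base (h ≫ P.map) (r + 1) := by
  have h₁ : IsSpherical i.coneCofib (ρ A ≫ h ≫ P.map) r S.hom.fst := S.fst.isSpherical hτ₁
  refine hasFaces_iff_coneCofib.2 ⟨hF ▸ h₁.congr fun k hk => ?_, ?_⟩
  · rw [if_neg (by omega), shiftIso_base]
  · rw [if_pos rfl, ← hF]
    exact S.hom.w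

/-- Homotopies between homotopies of pairs. -/
theorem Htpy.pair_homotopic_iff (hτ₁ : τ.fst = bdry i.coneCofib (r + 1))
    (hτ₂ : τ.snd = bdry i (r + 1))
    {S T : Htpy (A := pairIter A r) τ (pairBaseIter P h r) (pairBaseIter P h r)}
    {F F' : iterCone (r + 3) A ⟶ P.fst} (hF : S.hom.fst = (shiftIso A (r + 2)).hom ≫ F)
    (hF' : T.hom.fst = (shiftIso A (r + 2)).hom ≫ F') :
    S ≈ T ↔ ∃ (H : iterCone (r + 4) A ⟶ P.fst) (K : iterCone (r + 3) A ⟶ P.snd),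
      HasFaces i (h ≫ P.map) (r + 2) H (fun k => if k = 0 then F' else if k = 1 then F else
        if k = r + 3 then K ≫ P.map else base (h ≫ P.map) (r + 2)) ∧
      HasFaces i h (r + 1) K
        fun k => if k = 0 then T.hom.snd else if k = 1 then S.hom.snd else base h (r + 1) := by
  have h₁ : IsSpherical i.coneCofib (ρ A ≫ h ≫ P.map) r S.hom.fst := S.fst.isSpherical hτ₁
  have h₂ : IsSpherical i h r S.hom.snd := S.snd.isSpherical hτ₂
  constructor
  · rintro ⟨L⟩
    obtain ⟨H, hH⟩ : ∃ H : iterCone (r + 4) A ⟶ P.fst, (shiftIso A (r + 3)).hom ≫ H = L.hom.fst :=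
      ⟨(shiftIso A (r + 3)).inv ≫ L.hom.fst, Iso.hom_inv_id_assoc _ _⟩
    have hl := (homotopy_iff hτ₁ h₁ (H := L.hom.fst) (G := T.hom.fst)).1
      ⟨congrArg CofPair.Hom.fst L.left, congrArg CofPair.Hom.fst L.right⟩
    have hr := (homotopy_iff hτ₂ h₂ (H := L.hom.snd) (G := T.hom.snd)).1
      ⟨congrArg CofPair.Hom.snd L.left, congrArg CofPair.Hom.snd L.right⟩
    refine ⟨H, L.hom.snd, hasFaces_iff_coneCofib.2 ⟨?_, ?_⟩, hr⟩
    · rw [hH]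
      refine hl.congr fun k hk => ?_
      rw [if_neg (by omega : ¬ k = r + 3), hF, hF', ← shiftIso_base]
      split_ifs <;> rfl
    · rw [hH, if_neg (by omega), if_neg (by omega), if_pos rfl]
      exact L.hom.w
  · rintro ⟨H, K, hH, hK⟩
    obtain ⟨hl, hw⟩ := hasFaces_iff_coneCofib.1 hH
    have hl' := (homotopy_iff hτ₁ h₁ (H := (shiftIso A (r + 3)).hom ≫ H) (G := T.hom.fst)).2
      (hl.congr fun k hk => by
        rw [if_neg (by omega : ¬ k = r + 3), hF, hF', ← shiftIso_base]
        split_ifs <;> rfl)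
    have hr := (homotopy_iff hτ₂ h₂ (H := K) (G := T.hom.snd)).2 hK
    rw [if_neg (by omega), if_neg (by omega), if_pos rfl] at hw
    exact ⟨⟨⟨(shiftIso A (r + 3)).hom ≫ H, K, hw⟩, CofPair.hom_ext hl'.1 hr.1,
      CofPair.hom_ext hl'.2 hr.2⟩⟩

end Level

/-! ### Exactness -/

section Exactness

variable {P : CofPair C} {A : C} {i : Cofib A} {h : cone A ⟶ P.snd} {r : ℕ}
  {σ τ : Cofib (cone (pairIter A r))} {g : pairIter A r ⟶ pairIter A r}

/-- The homotopy of pairs `(F, h ρʳ⁺¹)` that represents the image of `[F]` under `(1, 1)^* θ`. -/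
def Htpy.liftPull (hσ : IsIso σ.hom.snd) (sq : ∃ k, τ.hom ≫ coneMap g = k ≫ σ.hom)
    (w : coneMap g ≫ pairBaseIter P h r = pairBaseIter P h r)
    (F : Htpy (A := iterCone r (cone A)) σ.fst (base (ρ A ≫ h ≫ P.map) r)
      (base (ρ A ≫ h ≫ P.map) r)) :
    Htpy (A := pairIter A r) τ (pairBaseIter P h r) (pairBaseIter P h r) :=
  Htpy.pull g sq w (Htpy.lift (P := P) (i := σ) (f₀ := pairBaseIter P h r)
    (f₁ := pairBaseIter P h r) hσ rfl F)

theorem Htpy.liftPull_fst (hg : g = 𝟙 _) (hσ : IsIso σ.hom.snd)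
    (sq : ∃ k, τ.hom ≫ coneMap g = k ≫ σ.hom)
    (w : coneMap g ≫ pairBaseIter P h r = pairBaseIter P h r)
    (F : Htpy (A := iterCone r (cone A)) σ.fst (base (ρ A ≫ h ≫ P.map) r)
      (base (ρ A ≫ h ≫ P.map) r)) : (Htpy.liftPull hσ sq w F).hom.fst = F.hom := by
  subst hg
  change coneMap (coneMap (𝟙 _)) ≫ F.hom = F.hom
  rw [coneMap_id, coneMap_id, Category.id_comp]

theorem Htpy.liftPull_snd (hg : g = 𝟙 _) (hσ : IsIso σ.hom.snd)
    (sq : ∃ k, τ.hom ≫ coneMap g = k ≫ σ.hom)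
    (w : coneMap g ≫ pairBaseIter P h r = pairBaseIter P h r)
    (F : Htpy (A := iterCone r (cone A)) σ.fst (base (ρ A ≫ h ≫ P.map) r)
      (base (ρ A ≫ h ≫ P.map) r)) : (Htpy.liftPull hσ sq w F).hom.snd = base h (r + 1) := by
  subst hg
  change coneMap (coneMap (𝟙 _)) ≫ base h (r + 1) = base h (r + 1)
  rw [coneMap_id, coneMap_id, Category.id_comp]

theorem const_fst : (Htpy.const τ (pairBaseIter P h r)).hom.fst =
    (shiftIso A (r + 2)).hom ≫ base (h ≫ P.map) (r + 2) :=
  (shiftIso_base (h ≫ P.map) (r + 1)).symm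

theorem const_snd : (Htpy.const τ (pairBaseIter P h r)).hom.snd = base h (r + 1) := rfl

/-- Exactness at `π(X, f h)`, for the groups `π_1`. If `(F, h ρ)` is homotopic to the constant by
`(H, K)`, then the last face of `H` is `f K`, and its face `0` is `F`. -/
theorem HBracket.mem_range_push_iff (hσ₁ : σ.fst = bdry i.next (r + 1)) (hσ₂ : IsIso σ.hom.snd)
    (hτ₁ : τ.fst = bdry i.coneCofib (r + 1)) (hτ₂ : τ.snd = bdry i (r + 1)) (hg : g = 𝟙 _)
    (sq : ∃ k, τ.hom ≫ coneMap g = k ≫ σ.hom)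
    (w : coneMap g ≫ pairBaseIter P h r = pairBaseIter P h r)
    (w' : base (ρ A ≫ h) r ≫ P.map = base (ρ A ≫ h ≫ P.map) r)
    (x : HBracket (A := iterCone r (cone A)) σ.fst (base (ρ A ≫ h ≫ P.map) r)
      (base (ρ A ≫ h ≫ P.map) r)) :
    (∃ y, HBracket.push (A := iterCone r (cone A)) P.map σ.fst (base (ρ A ≫ h) r)
      (base (ρ A ≫ h ≫ P.map) r) w' y = x) ↔
    HBracket.pull g τ σ sq _ _ w
      (HBracket.theta ⟨pairIter A r, σ, pairBaseIter P h r⟩ hσ₂ x) = 1 := by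
  constructor
  · rintro ⟨y, rfl⟩
    induction y using Quotient.inductionOn with | _ K'
    obtain ⟨K₀, hK₀⟩ : ∃ K₀ : iterCone (r + 3) A ⟶ P.snd,
        K'.hom = (shiftIso A (r + 2)).hom ≫ K₀ :=
      ⟨(shiftIso A (r + 2)).inv ≫ K'.hom, (Iso.hom_inv_id_assoc _ _).symm⟩
    have hs : IsSpherical i h (r + 1) K₀ := by
      rw [← isSpherical_next_iff, ← hK₀]
      exact K'.isSpherical hσ₁
    obtain ⟨K, hK, hR⟩ := hs.exists_lastRel
    obtain ⟨H, hH⟩ := (LastRel.symm hs hR).comp P.map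
    symm
    refine HBracket.sound (F := Htpy.const τ (pairBaseIter P h r))
      (G := Htpy.liftPull hσ₂ sq w (Htpy.push P.map w' K')) ?_
    refine (Htpy.pair_homotopic_iff hτ₁ hτ₂ const_fst (F' := K₀ ≫ P.map) ?_).2 ⟨H, K, ?_, ?_⟩
    · refine (Htpy.liftPull_fst hg _ _ _ _).trans ?_
      change K'.hom ≫ P.map = _
      rw [hK₀, Category.assoc]
    · exact hH.congr fun k hk => by split_ifs <;> first | rfl | omega
    · rw [Htpy.liftPull_snd hg, const_snd]
      exact hK.congr fun k hk => by split_ifs <;> rfl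
  · induction x using Quotient.inductionOn with | _ F
    intro hx
    obtain ⟨F₀, hF₀⟩ : ∃ F₀ : iterCone (r + 3) A ⟶ P.fst,
        F.hom = (shiftIso A (r + 2)).hom ≫ F₀ :=
      ⟨(shiftIso A (r + 2)).inv ≫ F.hom, (Iso.hom_inv_id_assoc _ _).symm⟩
    have hx' : Htpy.const τ (pairBaseIter P h r) ≈ Htpy.liftPull hσ₂ sq w F :=
      HBracket.exact hx.symm
    obtain ⟨H, K, hH, hK⟩ := (Htpy.pair_homotopic_iff hτ₁ hτ₂ const_fst
      ((Htpy.liftPull_fst hg hσ₂ sq w F).trans hF₀)).1 hx'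
    rw [Htpy.liftPull_snd hg, const_snd] at hK
    have hs : IsSpherical i h (r + 1) K := hK.congr fun k hk => by
      split_ifs <;> rfl
    have hR : LastRel i (h ≫ P.map) (r + 1) (K ≫ P.map) F₀ :=
      ⟨H, hH.congr fun k hk => by split_ifs <;> first | rfl | omega⟩
    obtain ⟨K', hK', hR'⟩ := hs.exists_lastRel
    obtain ⟨L, hL⟩ := hR.sphHomotopic (hs.comp P.map) (hR'.comp P.map)
    refine ⟨HBracket.mk (Htpy.ofSpherical hσ₁ (isSpherical_next_iff.2 hK')), ?_⟩
    refine HBracket.sound (F := Htpy.push P.map w'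
      (Htpy.ofSpherical hσ₁ (isSpherical_next_iff.2 hK'))) (G := F) ?_
    refine (Htpy.homotopic_iff hσ₁).2 ⟨(shiftIso A (r + 3)).hom ≫ L, ?_⟩
    refine HasFaces.congr ((hasFaces_next_iff' (by simp)).2 hL) fun k hk => ?_
    rw [hF₀]
    split_ifs
    · rfl
    · exact (Category.assoc _ _ _).symm
    · exact shiftIso_base _ _

/-- Exactness at `π((X, Y), h)`, for the groups `π_1`: a homotopy of the last face `f G` to the constant
extends to the simplex `F`. -/
theorem HBracket.mem_range_pull_iff (hσ₁ : σ.fst = bdry i.next (r + 1)) (hσ₂ : IsIso σ.hom.snd)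
    (hτ₁ : τ.fst = bdry i.coneCofib (r + 1)) (hτ₂ : τ.snd = bdry i (r + 1)) (hg : g = 𝟙 _)
    (sq : ∃ k, τ.hom ≫ coneMap g = k ≫ σ.hom)
    (w : coneMap g ≫ pairBaseIter P h r = pairBaseIter P h r)
    (z : HBracket (A := pairIter A r) τ (pairBaseIter P h r) (pairBaseIter P h r)) :
    (∃ x, HBracket.pull g τ σ sq _ _ w
      (HBracket.theta ⟨pairIter A r, σ, pairBaseIter P h r⟩ hσ₂ x) = z) ↔
    HBracket.snd ⟨pairIter A r, τ, pairBaseIter P h r⟩ z = 1 := by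
  constructor
  · rintro ⟨x, rfl⟩
    induction x using Quotient.inductionOn with | _ F
    exact congrArg HBracket.mk (Htpy.ext (Htpy.liftPull_snd hg hσ₂ sq w F))
  · induction z using Quotient.inductionOn with | _ S
    intro hz
    obtain ⟨F, hF⟩ : ∃ F : iterCone (r + 3) A ⟶ P.fst,
        S.hom.fst = (shiftIso A (r + 2)).hom ≫ F :=
      ⟨(shiftIso A (r + 2)).inv ≫ S.hom.fst, (Iso.hom_inv_id_assoc _ _).symm⟩
    obtain ⟨K, hK⟩ := (Htpy.homotopic_iff (F := S.snd) (G := Htpy.const τ.snd (base h r)) hτ₂).1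
      (HBracket.exact hz)
    obtain ⟨W, H, hH, hW⟩ := exists_extension_of_last (S.fst_hasFaces hτ₁ hF)
      (K := K ≫ P.map) ((hK.comp P.map).congr fun k hk => by
        rw [base_comp]
        split_ifs <;> first | rfl | omega)
    refine ⟨HBracket.mk (Htpy.ofSpherical hσ₁ (isSpherical_next_iff.2 hH)), ?_⟩
    symm
    refine HBracket.sound (F := S) (G := Htpy.liftPull hσ₂ sq w
      (Htpy.ofSpherical hσ₁ (isSpherical_next_iff.2 hH))) ?_
    refine (Htpy.pair_homotopic_iff hτ₁ hτ₂ hF (Htpy.liftPull_fst hg hσ₂ sq w _)).2 ⟨W, K, hW, ?_⟩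
    rw [Htpy.liftPull_snd hg]
    exact hK

/-- Exactness at `π(Y, h)`, for the groups `π_1`: some simplex has the last face `f G` and all other
faces constant if and only if some homotopy joins `f G` to the constant. -/
theorem HBracket.mem_range_snd_iff (hτ₁ : τ.fst = bdry i.coneCofib (r + 1))
    (hτ₂ : τ.snd = bdry i (r + 1)) (w' : base h r ≫ P.map = base (h ≫ P.map) r)
    (y : HBracket (A := iterCone r A) τ.snd (base h r) (base h r)) :
    (∃ z, HBracket.snd ⟨pairIter A r, τ, pairBaseIter P h r⟩ z = y) ↔
      HBracket.push (A := iterCone r A) P.map τ.snd (base h r) (base (h ≫ P.map) r) w' y =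
        HBracket.mk (Htpy.const τ.snd (base (h ≫ P.map) r)) := by
  constructor
  · rintro ⟨z, rfl⟩
    induction z using Quotient.inductionOn with | _ S
    obtain ⟨F, hF⟩ : ∃ F : iterCone (r + 3) A ⟶ P.fst,
        S.hom.fst = (shiftIso A (r + 2)).hom ≫ F :=
      ⟨(shiftIso A (r + 2)).inv ≫ S.hom.fst, (Iso.hom_inv_id_assoc _ _).symm⟩
    have hs : IsSpherical i h r S.hom.snd := S.snd.isSpherical hτ₂
    have hR : LastRel i (h ≫ P.map) r (S.hom.snd ≫ P.map) (base (h ≫ P.map) (r + 1)) :=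
      ⟨F, (S.fst_hasFaces hτ₁ hF).congr fun k hk => by split_ifs <;> first | rfl | omega⟩
    refine HBracket.sound (F := Htpy.push P.map w' S.snd)
      (G := Htpy.const τ.snd (base (h ≫ P.map) r)) ?_
    -- `LastRel` is symmetric, so `f G` and the constant are both joined to the constant last face.
    exact (Htpy.homotopic_iff hτ₂).2 ((lastRel_base i (h ≫ P.map) r).sphHomotopic
      (isSpherical_base _ _ _) (LastRel.symm (hs.comp P.map) hR))
  · induction y using Quotient.inductionOn with | _ G
    intro hy
    have hs : IsSpherical i h r G.hom := G.isSpherical hτ₂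
    obtain ⟨H, hH⟩ := (Htpy.homotopic_iff (F := Htpy.const τ.snd (base (h ≫ P.map) r))
      (G := Htpy.push P.map w' G) hτ₂).1 (HBracket.exact hy.symm)
    have hR : LastRel i (h ≫ P.map) r (base (h ≫ P.map) (r + 1)) (G.hom ≫ P.map) :=
      ⟨H, hH.congr fun k hk => by split_ifs <;> rfl⟩
    obtain ⟨F, hF⟩ := LastRel.symm (isSpherical_base _ _ _) hR
    exact ⟨HBracket.mk (Htpy.ofLast hτ₁ hτ₂ hs (F := F)
      (hF.congr fun k hk => by split_ifs <;> first | rfl | omega)), rfl⟩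

end Exactness

theorem coneMap_pairIter_id {A : C} {r : ℕ} {g : pairIter A r ⟶ pairIter A r} (hg : g = 𝟙 _) :
    coneMap g = 𝟙 (pairIter A (r + 1)) := by
  subst hg
  exact coneMap_id _

/-- Exactness at `π(X, f h)`. Passing from `n + 1` to `n` replaces the cofibrations by their relative
cones. -/
theorem HGroup.mem_range_push_iff {P : CofPair C} {A : C} {i : Cofib A} {h : cone A ⟶ P.snd}
    (n r : ℕ) {σ τ : Cofib (cone (pairIter A r))} {g : pairIter A r ⟶ pairIter A r}
    (hσ₁ : σ.fst = bdry i.next (r + 1)) (hσ₂ : IsIso σ.hom.snd)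
    (hτ₁ : τ.fst = bdry i.coneCofib (r + 1)) (hτ₂ : τ.snd = bdry i (r + 1)) (hg : g = 𝟙 _)
    (sq : ∃ k, τ.hom ≫ coneMap g = k ≫ σ.hom)
    (w : coneMap g ≫ pairBaseIter P h r = pairBaseIter P h r)
    (w' : base (ρ A ≫ h) r ≫ P.map = base (ρ A ≫ h ≫ P.map) r)
    (x : HGroup ⟨iterCone r (cone A), σ.fst, base (ρ A ≫ h ≫ P.map) r⟩ n) :
    (∃ y, HGroup.push (A := iterCone r (cone A)) P.map n σ.fst (base (ρ A ≫ h) r)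
      (base (ρ A ≫ h ≫ P.map) r) w' y = x) ↔
    HGroup.pull n g τ σ sq _ _ w
      (HGroup.theta n ⟨pairIter A r, σ, pairBaseIter P h r⟩ hσ₂ x) = 1 := by
  induction n generalizing r with
  | zero => exact HBracket.mem_range_push_iff hσ₁ hσ₂ hτ₁ hτ₂ hg sq w w' x
  | succ n ih =>
    exact ih (r + 1) (σ := σ.next) (τ := τ.next) (g := coneMap g) (congrArg Cofib.next hσ₁)
      (@Cofib.next_isIso _ _ _ _ σ.snd hσ₂) (congrArg Cofib.next hτ₁) (congrArg Cofib.next hτ₂)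
      (coneMap_pairIter_id hg) (Cofib.next_sq sq) _ _ x

/-- Exactness at `π((X, Y), h)`. -/
theorem HGroup.mem_range_pull_iff {P : CofPair C} {A : C} {i : Cofib A} {h : cone A ⟶ P.snd}
    (n r : ℕ) {σ τ : Cofib (cone (pairIter A r))} {g : pairIter A r ⟶ pairIter A r}
    (hσ₁ : σ.fst = bdry i.next (r + 1)) (hσ₂ : IsIso σ.hom.snd)
    (hτ₁ : τ.fst = bdry i.coneCofib (r + 1)) (hτ₂ : τ.snd = bdry i (r + 1)) (hg : g = 𝟙 _)
    (sq : ∃ k, τ.hom ≫ coneMap g = k ≫ σ.hom)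
    (w : coneMap g ≫ pairBaseIter P h r = pairBaseIter P h r)
    (z : HGroup ⟨pairIter A r, τ, pairBaseIter P h r⟩ n) :
    (∃ x, HGroup.pull n g τ σ sq _ _ w
      (HGroup.theta n ⟨pairIter A r, σ, pairBaseIter P h r⟩ hσ₂ x) = z) ↔
    HGroup.snd n ⟨pairIter A r, τ, pairBaseIter P h r⟩ z = 1 := by
  induction n generalizing r with
  | zero => exact HBracket.mem_range_pull_iff hσ₁ hσ₂ hτ₁ hτ₂ hg sq w z
  | succ n ih =>
    exact ih (r + 1) (σ := σ.next) (τ := τ.next) (g := coneMap g) (congrArg Cofib.next hσ₁)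
      (@Cofib.next_isIso _ _ _ _ σ.snd hσ₂) (congrArg Cofib.next hτ₁) (congrArg Cofib.next hτ₂)
      (coneMap_pairIter_id hg) (Cofib.next_sq sq) _ z

/-- Exactness at `π(Y, h)`. -/
theorem HGroup.mem_range_snd_iff {P : CofPair C} {A : C} {i : Cofib A} {h : cone A ⟶ P.snd}
    (n r : ℕ) {τ : Cofib (cone (pairIter A r))} (hτ₁ : τ.fst = bdry i.coneCofib (r + 1))
    (hτ₂ : τ.snd = bdry i (r + 1)) (w' : base h r ≫ P.map = base (h ≫ P.map) r)
    (y : HGroup ⟨iterCone r A, τ.snd, base h r⟩ n) :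
    (∃ z, HGroup.snd n ⟨pairIter A r, τ, pairBaseIter P h r⟩ z = y) ↔
      HGroup.push (A := iterCone r A) P.map n τ.snd (base h r) (base (h ≫ P.map) r) w' y = 1 := by
  induction n generalizing r with
  | zero => exact HBracket.mem_range_snd_iff hτ₁ hτ₂ w' y
  | succ n ih =>
    exact ih (r + 1) (τ := τ.next) (congrArg Cofib.next hτ₁) (congrArg Cofib.next hτ₂) _ y

end GenHtpy

theorem mainTheorem1 {C : Type u} [CategoryTheory.Category.{v} C] [GenHtpy.NaturalCone C] {A X Y : C}
    (i : GenHtpy.Cofib A) (f : Y ⟶ X) (hf : GenHtpy.IsCof f) (h : GenHtpy.cone A ⟶ Y) (n : ℕ) :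
    (GenHtpy.fStar ⟨X, Y, f, hf⟩ i h (n + 1)).range = (GenHtpy.jHom ⟨X, Y, f, hf⟩ i h n).ker ∧
      (GenHtpy.jHom ⟨X, Y, f, hf⟩ i h n).range = (GenHtpy.deltaHom ⟨X, Y, f, hf⟩ i h n).ker ∧
      (GenHtpy.deltaHom ⟨X, Y, f, hf⟩ i h n).range = (GenHtpy.fStar ⟨X, Y, f, hf⟩ i h n).ker := by
  refine ⟨?_, ?_, ?_⟩
  · ext x
    exact GenHtpy.HGroup.mem_range_push_iff (P := ⟨X, Y, f, hf⟩) (i := i) (h := h) n 0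
      (σ := i.sigmaPair.next) (τ := i.conePair.next) (g := 𝟙 _) rfl
      (@GenHtpy.Cofib.next_isIso _ _ _ _ i.sigmaPair.snd (inferInstanceAs (IsIso (𝟙 A)))) rfl rfl rfl
      (GenHtpy.Cofib.next_sq i.conePair_sq) _ _ x
  · ext z
    exact GenHtpy.HGroup.mem_range_pull_iff (P := ⟨X, Y, f, hf⟩) (i := i) (h := h) n 0
      (σ := i.sigmaPair.next) (τ := i.conePair.next) (g := 𝟙 _) rfl
      (@GenHtpy.Cofib.next_isIso _ _ _ _ i.sigmaPair.snd (inferInstanceAs (IsIso (𝟙 A)))) rfl rfl rfl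
      (GenHtpy.Cofib.next_sq i.conePair_sq) _ z
  · ext y
    exact GenHtpy.HGroup.mem_range_snd_iff (P := ⟨X, Y, f, hf⟩) (i := i) (h := h) n 0
      (τ := i.conePair.next) rfl rfl _ y
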